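/- **Setting.** On $\mathbb R^{1+3}\times\mathbb S^1$, $\mathbb S^1=\mathbb R/2\pi\mathbb Z$, use coordinates $x^0=t$, $x=(x^1,x^2,x^3)$, $x^4=y$; Greek indices run over $0,\dots,4$, the indices $a,b$ over $1,2,3$, repeated indices are summed. Let $r=|x|$, $s=\sqrt{t^2-r^2}$, $\Box_{xy}=-\partial_t^2+\Delta_x+\partial_y^2$, $\mathcal S=t\partial_t+x^a\partial_a$, $\underline\partial_0=\partial_t$, $\underline\partial_a=\partial_a+\frac{x^a}{t}\partial_t$, $\underline\partial_4=\partial_y$, $f^\flat=\frac1{2\pi}\int_{\mathbb S^1}f\,dy$, and $f_\lambda(t,x,y)=f(\frac{\lambda t}{s},\frac{\lambda x}{s},y)$. Let $\mathcal D^{\rm i}=\{t\ge 1+\sqrt{1+r^2}\}$ and $\mathcal H_{[s_0,S_0)}=\{(t,x,y)\in\mathcal D^{\rm i}: s_0\le s<S_0\}$, where $s_0\ge 2$. Let $\chi\in C^\infty(\mathbb R)$, $\chi\ge0$, $\chi=0$ on $(-\infty,\frac12]$, $\chi=1$ on $[\frac34,\infty)$, let $M>0$ and $a(t,x)=\chi(\frac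 rt)\chi(r)\frac Mr$. A symmetric tensor field $H^{\mu\nu}$ is split as $H=H^0+H^1$, with $H^{0,\mu\nu}=-a\,\delta^{\mu\nu}$ for $\mu,\nu\le 3$ and $H^{0,\mu4}=H^{0,4\mu}=0$. Let $\mathcal U=\{L,\underline L,S^1,S^2,\partial_y\}$ with $L=\partial_t+\partial_r$, $\underline L=\partial_t-\partial_r$ and $S^1,S^2$ a pointwise orthonormal frame of the spheres $r=\mathrm{const}$ (at $x=0$, $\partial_r,S^1,S^2$ is any orthonormal frame). $\pi^{UV}$ and $\pi_{UV}$ denote the components of a tensor in this frame, indices being lowered with $\bar g=\mathrm{diag}(-1,1,1,1,1)$. The coefficients $c^{\alpha\beta}_{UV},d^\gamma_{UV}$ are defined by $U=\tilde U^\alpha\underline\partial_\alpha$, $c_{UV}^{\alpha\beta}=\tilde U^\alpha\tilde V^\beta$ and $U^\mu V^\nu\partial_\mu\partial_\nu=c_{UV}^{\alpha\beta}\underline\partial_\alpha\underline\partial_\beta+d_{UV}^\gamma\underline\partial_\gamma$. For functions $\phi,F$ set $$Q[\phi]=\tfrac34\phi+s^2\Big(\tfrac{2x^a}{t}\underline\partial_a\partial_t\phi+s^{-2}x^ax^b\underline\partial_a\underline\partial_b\phi-\tfrac{r^2}{t^3}\partial_t\phi+\tfrac3t\partial_t\phi+3s^{-2}x^a\underline\partial_a\phi\Big),$$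 $$R_0[\phi]=s^2\,\underline\partial^a\underline\partial_a\phi+x^ax^b\underline\partial_a\underline\partial_b\phi+\tfrac34\phi+3x^a\underline\partial_a\phi,$$ $$R^0_1[\phi]=s^2a\Big(\tfrac{x^b}{t}\partial_t\underline\partial_b\phi+\tfrac{x^b}{t}\underline\partial_b\partial_t\phi-\underline\partial^b\underline\partial_b\phi+\tfrac3t\partial_t\phi\Big),\qquad R^0_2[\phi]=a\,\tfrac{t^2+r^2}{s^2}\,Q[\phi],$$ $$R^1_1[\phi]=s^2(H^{1,UV})^\flat\Big(\sum_{(\alpha,\beta):\ \alpha\in\{1,2,3\}\text{ or }\beta\in\{1,2,3\}}c^{\alpha\beta}_{UV}\underline\partial_\alpha\underline\partial_\beta\phi+d^\gamma_{UV}\underline\partial_\gamma\phi\Big),$$ $$R^1_2[\phi]=-\tfrac ts(H^{1,UV})^\flat(c^{04}_{UV}+c^{40}_{UV})\,s\big(\tfrac32\partial_y\phi+x^a\partial_y\underline\partial_a\phi\big),\qquad R^1_3[\phi]=-\big(\tfrac ts\big)^2(H^{1,UV})^\flat c^{00}_{UV}\,Q[\phi],$$ $$R[\phi]=R_0[\phi]+\sum_{i=1}^2R^0_i[\phi]+\sum_{i=1}^3R^1_i[\phi]-s^2F,$$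 and, for $(t,x)$ with $t>r$ and $\lambda>0$, $$Y_{tx}(\lambda)^2=\int_{\mathbb S^1}\lambda\big|\tfrac32\phi_\lambda+(\mathcal S\phi)_\lambda\big|^2+\lambda^3|\partial_y\phi_\lambda|^2\,dy,\qquad B_{tx}(\lambda)^2=\int_{\mathbb S^1}\lambda^{-1}|(R[\phi])_\lambda|^2\,dy,$$ $$A_{tx}(\lambda)=\sup_{\mathbb S^1}\Big|\lambda^{-1}\Big(\mathcal S\big((\tfrac ts)^2(H^{1,UV})^\flat c^{00}_{UV}\big)\Big)_\lambda\Big|+\sup_{\mathbb S^1}\big|\lambda^{-1}(\mathcal S(H^{1,44})^\flat)_\lambda\big|+\sup_{\mathbb S^1}\Big|\lambda^{-1}\big(\chi(\tfrac rt)\chi'(r)(\tfrac ts)^2M\big)_\lambda\Big|.$$ **Proposition.** There is an absolute constant $\varepsilon_0>0$, and for every $\chi$ as above and every $M_0$ there is a constant $C>0$ depending only on $\chi$ and $M_0$, such that the following holds for all $0<M\le M_0$ and all $2\le s_0$, $S_0$. Let $H^{\mu\nu}$ be a symmetric tensor field, $C^1$ near $\mathcal H_{[s_0,S_0)}$, with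 $$|(H^{1,\mu\nu})^\flat|\le\varepsilon_0,\qquad |(H^1_{LL})^\flat|\le\varepsilon_0\,(s/t)^2\qquad\text{in }\mathcal H_{[s_0,S_0)},$$ and let $\phi$ be $C^2$ near $\mathcal H_{[s_0,S_0)}$, with $\int_{\mathbb S^1}\phi\,dy=0$ and $\Box_{xy}\phi+(H^{\mu\nu})^\flat\partial_\mu\partial_\nu\phi=F$ in $\mathcal H_{[s_0,S_0)}$. Let $(t,x,y)\in\mathcal H_{[s_0,S_0)}$ and let $\lambda_0\in[s_0,s]$ be such that the point $(\frac{\lambda_0t}{s},\frac{\lambda_0x}{s})$ of the ray through $(t,x)$ lies in the interior region $\mathcal D^{\rm i}$ (so $\lambda_0=s_0$ is allowed if the ray meets the hyperboloid $s=s_0$ inside $\mathcal D^{\rm i}$; otherwise one may take for $\lambda_0$ the parameter $2t/s$ at which the ray enters $\mathcal D^{\rm i}$). Then $A_{tx}$ and $B_{tx}$ are integrable on $[\lambda_0,s]$ and $$s^{\frac32}\big(\|\phi\|_{L^2(\mathbb S^1)}+\|\partial_y\phi\|_{L^2(\mathbb S^1)}\big)+s^{\frac12}\|\mathcal S\phi\|_{L^2(\mathbb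 S^1)}\le C\Big(Y_{tx}(\lambda_0)+\int_{\lambda_0}^sB_{tx}(\lambda)\,d\lambda\Big)\exp\Big(\int_{\lambda_0}^sA_{tx}(\lambda)\,d\lambda\Big).$$ -/

import Mathlib

open scoped ContDiff

noncomputable section

namespace KaluzaKlein

/-! Coordinates. A point `p` of `ℝ^{1+3} × S¹` is written through the universal cover of the circle:
`p 0 = t`, `p 1, p 2, p 3` are the coordinates of `x`, and `p 4 = y`. Functions on
`ℝ^{1+3} × S¹`, `S¹ = ℝ / 2πℤ`, are functions of `p` that are `2π`-periodic in `p 4`. -/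

/-- The space `ℝ × ℝ³ × ℝ` of coordinates `(t, x, y)`. -/
abbrev Spacetime : Type := Fin 5 → ℝ

/-- The index in `{1, 2, 3} ⊆ Fin 5` of the `a`-th coordinate of `x`. -/
def spat (a : Fin 3) : Fin 5 := a.succ.castSucc

/-- `r = |x|`. -/
def radius (p : Spacetime) : ℝ := √(∑ a : Fin 3, p (spat a) ^ 2)

/-- `s = √(t² - r²)`. -/
def hypTime (p : Spacetime) : ℝ := √(p 0 ^ 2 - radius p ^ 2)

/-- The point `(t, x, y)` with the same `(t, x)` as `p`. -/
def onCircle (p : Spacetime) (y : ℝ) : Spacetime := Function.update p 4 y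

/-- The point `(λ t / s, λ x / s, y)` of the ray through the origin and `(t, x)`. -/
def ray (p : Spacetime) (lam : ℝ) : Spacetime :=
  fun μ => if μ = 4 then p 4 else lam * p μ / hypTime p

/-- The interior region `t ≥ 1 + √(1 + r²)`. -/
def interiorRegion : Set Spacetime := {p | 1 + √(1 + radius p ^ 2) ≤ p 0}

/-- The hyperbolic slab `H_{[s₀, S₀)}`: the points of the interior region with `s₀ ≤ s < S₀`. -/
def hypSlab (s₀ S₀ : ℝ) : Set Spacetime :=
  {p | p ∈ interiorRegion ∧ s₀ ≤ hypTime p ∧ hypTime p < S₀}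

/-- `f` is a function on `ℝ^{1+3} × S¹`. -/
def IsCirclePeriodic (f : Spacetime → ℝ) : Prop :=
  ∀ (p : Spacetime) (y : ℝ), f (onCircle p (y + 2 * Real.pi)) = f (onCircle p y)

/-! Derivatives. -/

/-- `∂_μ`. -/
def pd (μ : Fin 5) (f : Spacetime → ℝ) (p : Spacetime) : ℝ := fderiv ℝ f p (Pi.single μ 1)

/-- The derivatives of the hyperbolic frame: `∂_t` for `μ = 0`, `∂_a + (x^a / t) ∂_t` for
`μ = a ∈ {1, 2, 3}`, and `∂_y` for `μ = 4`. -/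
def hd (μ : Fin 5) (f : Spacetime → ℝ) (p : Spacetime) : ℝ :=
  pd μ f p + if μ = 0 ∨ μ = 4 then 0 else p μ / p 0 * pd 0 f p

/-- The scaling field `t ∂_t + x^a ∂_a`. -/
def scaling (f : Spacetime → ℝ) (p : Spacetime) : ℝ :=
  p 0 * pd 0 f p + ∑ a : Fin 3, p (spat a) * pd (spat a) f p

/-- The flat wave operator `-∂_t² + Δ_x + ∂_y²`. -/
def waveOp (f : Spacetime → ℝ) (p : Spacetime) : ℝ :=
  -pd 0 (pd 0 f) p + ∑ i : Fin 4, pd i.succ (pd i.succ f) p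

/-! The circle. -/

/-- The average over the circle, `f^♭`. -/
def flat (f : Spacetime → ℝ) (p : Spacetime) : ℝ :=
  (2 * Real.pi)⁻¹ * ∫ y in (0 : ℝ)..(2 * Real.pi), f (onCircle p y)

/-- The norm in `L²(S¹)` of `f(t, x, ·)`. -/
def circleNorm (f : Spacetime → ℝ) (p : Spacetime) : ℝ :=
  √(∫ y in (0 : ℝ)..(2 * Real.pi), f (onCircle p y) ^ 2)

/-! The tensor `H` and its Schwarzschild part. -/

/-- The cut-off function `χ`. -/
structure IsCutoff (χ : ℝ → ℝ) : Prop where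
  smooth : ContDiff ℝ ∞ χ
  nonneg : ∀ u, 0 ≤ χ u
  eq_zero : ∀ u, u ≤ 1 / 2 → χ u = 0
  eq_one : ∀ u, 3 / 4 ≤ u → χ u = 1

/-- A field of contravariant tensors of order two, given by its components. -/
abbrev TensorField : Type := Fin 5 → Fin 5 → Spacetime → ℝ

/-- `χ(r/t) χ(r) M / r`. -/
def tail (χ : ℝ → ℝ) (M : ℝ) (p : Spacetime) : ℝ :=
  χ (radius p / p 0) * χ (radius p) * (M / radius p)

/-- `H^{0,μν} = - χ(r/t) χ(r) (M/r) δ^{μν}` for `μ, ν ≤ 3`, and `0` if `μ = 4` or `ν = 4`. -/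
def schwarzschildPart (χ : ℝ → ℝ) (M : ℝ) : TensorField :=
  fun μ ν p => if μ = ν ∧ μ ≠ 4 then -tail χ M p else 0

/-- `(H^{1,μν})^♭`, where `H = H⁰ + H¹`. -/
def flatH1 (χ : ℝ → ℝ) (M : ℝ) (H : TensorField) : TensorField :=
  fun μ ν => flat (fun p => H μ ν p - schwarzschildPart χ M μ ν p)

/-! The null frame. -/

/-- An orthonormal frame `e 0, e 1, e 2` of `ℝ³` at each `x`, whose first vector is `x / |x|`
where `x ≠ 0` (at `x = 0` it is any unit vector); `e 1, e 2` span the tangent plane of the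
sphere through `x`. No dependence on `x` is prescribed, there being no global continuous choice. -/
structure SphereFrame where
  e : Fin 3 → (Fin 3 → ℝ) → Fin 3 → ℝ
  orthonormal : ∀ x i j, ∑ a, e i x a * e j x a = if i = j then 1 else 0
  radial : ∀ x a, x a = √(∑ b, x b ^ 2) * e 0 x a

/-- The null frame `L, L̲, S¹, S², ∂_y` (in this order), in components. -/
def nullVec (N : SphereFrame) (U : Fin 5) (p : Spacetime) : Fin 5 → ℝ :=
  let e : Fin 3 → Fin 3 → ℝ := fun i => N.e i (fun a => p (spat a))
  ![![1, e 0 0, e 0 1, e 0 2, 0],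
    ![1, -e 0 0, -e 0 1, -e 0 2, 0],
    ![0, e 1 0, e 1 1, e 1 2, 0],
    ![0, e 2 0, e 2 1, e 2 2, 0],
    ![0, 0, 0, 0, 1]] U

/-- `X_μ = ḡ_{μα} X^α` with `ḡ = diag(-1, 1, 1, 1, 1)`. -/
def lowerIdx (X : Fin 5 → ℝ) (μ : Fin 5) : ℝ := if μ = 0 then -X 0 else X μ

/-- `π_{XY} = π_{μν} X^μ Y^ν = π^{μν} X_μ Y_ν` at `p`. -/
def lowerComp (T : TensorField) (X Y : Fin 5 → ℝ) (p : Spacetime) : ℝ :=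
  ∑ μ, ∑ ν, T μ ν p * lowerIdx X μ * lowerIdx Y ν

/-- The components `ḡ^{UV}` of the inverse flat metric in the null frame. -/
def nullInv : Matrix (Fin 5) (Fin 5) ℝ :=
  !![0, -1 / 2, 0, 0, 0;
     -1 / 2, 0, 0, 0, 0;
     0, 0, 1, 0, 0;
     0, 0, 0, 1, 0;
     0, 0, 0, 0, 1]

/-- The components `π^{UV} = ḡ^{UU'} ḡ^{VV'} π_{U'V'}` of a tensor in the null frame. -/
def upperComp (N : SphereFrame) (T : TensorField) (U V : Fin 5) (p : Spacetime) : ℝ :=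
  ∑ U', ∑ V', nullInv U U' * nullInv V V' * lowerComp T (nullVec N U' p) (nullVec N V' p) p

/-! From the null frame to the hyperbolic frame. -/

/-- The coefficients in `∂_μ = ∑_α Ψ_μ^α ∂̲_α`, where `∂̲` is the hyperbolic frame:
`∂_t = ∂̲_0`, `∂_a = ∂̲_a - (x^a / t) ∂̲_0`, `∂_y = ∂̲_4`. -/
def hypTrans (μ α : Fin 5) (p : Spacetime) : ℝ :=
  (if μ = α then 1 else 0) - if α = 0 ∧ μ ≠ 0 ∧ μ ≠ 4 then p μ / p 0 else 0

/-- `c_{UV}^{αβ}` in `U^μ V^ν ∂_μ ∂_ν = c_{UV}^{αβ} ∂̲_α ∂̲_β + d_{UV}^γ ∂̲_γ`. -/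
def cCoef (N : SphereFrame) (U V α β : Fin 5) (p : Spacetime) : ℝ :=
  (∑ μ, nullVec N U p μ * hypTrans μ α p) * ∑ ν, nullVec N V p ν * hypTrans ν β p

/-- `d_{UV}^γ` in `U^μ V^ν ∂_μ ∂_ν = c_{UV}^{αβ} ∂̲_α ∂̲_β + d_{UV}^γ ∂̲_γ`. -/
def dCoef (N : SphereFrame) (U V γ : Fin 5) (p : Spacetime) : ℝ :=
  ∑ μ, ∑ ν, nullVec N U p μ * nullVec N V p ν * pd μ (hypTrans ν γ) p

/-- `π^{UV} c_{UV}^{αβ}`. -/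
def cSum (N : SphereFrame) (T : TensorField) (α β : Fin 5) (p : Spacetime) : ℝ :=
  ∑ U, ∑ V, upperComp N T U V p * cCoef N U V α β p

/-- `π^{UV} d_{UV}^γ`. -/
def dSum (N : SphereFrame) (T : TensorField) (γ : Fin 5) (p : Spacetime) : ℝ :=
  ∑ U, ∑ V, upperComp N T U V p * dCoef N U V γ p

/-! The remainder. In `R11`, `R12`, `R13` the argument `T` stands for `(H¹)^♭`. -/

/-- `x^a ∂̲_a φ`. -/
def xHd (φ : Spacetime → ℝ) (p : Spacetime) : ℝ := ∑ a, p (spat a) * hd (spat a) φ p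

/-- `x^a x^b ∂̲_a ∂̲_b φ`. -/
def xxHd (φ : Spacetime → ℝ) (p : Spacetime) : ℝ :=
  ∑ a, ∑ b, p (spat a) * p (spat b) * hd (spat a) (hd (spat b) φ) p

/-- `∂̲^a ∂̲_a φ`. -/
def hypLap (φ : Spacetime → ℝ) (p : Spacetime) : ℝ := ∑ a, hd (spat a) (hd (spat a) φ) p

/-- `Q[φ]`. -/
def Q (φ : Spacetime → ℝ) (p : Spacetime) : ℝ :=
  3 / 4 * φ p +
    hypTime p ^ 2 *
      (2 * (∑ a, p (spat a) / p 0 * hd (spat a) (pd 0 φ) p)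
        + (hypTime p ^ 2)⁻¹ * xxHd φ p
        - radius p ^ 2 / p 0 ^ 3 * pd 0 φ p
        + 3 / p 0 * pd 0 φ p
        + 3 * (hypTime p ^ 2)⁻¹ * xHd φ p)

/-- `R_0[φ]`. -/
def R0 (φ : Spacetime → ℝ) (p : Spacetime) : ℝ :=
  hypTime p ^ 2 * hypLap φ p + xxHd φ p + 3 / 4 * φ p + 3 * xHd φ p

/-- `R^0_1[φ]`. -/
def R01 (χ : ℝ → ℝ) (M : ℝ) (φ : Spacetime → ℝ) (p : Spacetime) : ℝ :=
  hypTime p ^ 2 * tail χ M p *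
    ((∑ a, p (spat a) / p 0 * pd 0 (hd (spat a) φ) p)
      + (∑ a, p (spat a) / p 0 * hd (spat a) (pd 0 φ) p)
      - hypLap φ p + 3 / p 0 * pd 0 φ p)

/-- `R^0_2[φ]`. -/
def R02 (χ : ℝ → ℝ) (M : ℝ) (φ : Spacetime → ℝ) (p : Spacetime) : ℝ :=
  tail χ M p * ((p 0 ^ 2 + radius p ^ 2) / hypTime p ^ 2) * Q φ p

/-- `R^1_1[φ]`: the second order terms in which at least one derivative is one of
`∂̲_1, ∂̲_2, ∂̲_3`, each taken once, and the first order terms. -/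
def R11 (N : SphereFrame) (T : TensorField) (φ : Spacetime → ℝ) (p : Spacetime) : ℝ :=
  hypTime p ^ 2 *
    ((∑ α, ∑ β, if (α ≠ 0 ∧ α ≠ 4) ∨ (β ≠ 0 ∧ β ≠ 4) then cSum N T α β p * hd α (hd β φ) p else 0)
      + ∑ γ, dSum N T γ p * hd γ φ p)

/-- `R^1_2[φ]`; the coefficient of `∂_t ∂_y = ∂_y ∂_t` is `c^{04} + c^{40}`. -/
def R12 (N : SphereFrame) (T : TensorField) (φ : Spacetime → ℝ) (p : Spacetime) : ℝ :=
  -(p 0 / hypTime p) * (cSum N T 0 4 p + cSum N T 4 0 p) *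
    (hypTime p * (3 / 2 * pd 4 φ p + ∑ a, p (spat a) * pd 4 (hd (spat a) φ) p))

/-- `R^1_3[φ]`. -/
def R13 (N : SphereFrame) (T : TensorField) (φ : Spacetime → ℝ) (p : Spacetime) : ℝ :=
  -(p 0 / hypTime p) ^ 2 * cSum N T 0 0 p * Q φ p

/-- `R[φ]`. -/
def remainder (χ : ℝ → ℝ) (M : ℝ) (N : SphereFrame) (H : TensorField) (φ F : Spacetime → ℝ)
    (p : Spacetime) : ℝ :=
  R0 φ p + (R01 χ M φ p + R02 χ M φ p)
    + (R11 N (flatH1 χ M H) φ p + R12 N (flatH1 χ M H) φ p + R13 N (flatH1 χ M H) φ p)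
    - hypTime p ^ 2 * F p

/-! The functions `Y`, `A`, `B` of the parameter `λ` on the ray through `(t, x)`. -/

/-- `Y_{tx}(λ)`. -/
def Y (φ : Spacetime → ℝ) (p : Spacetime) (lam : ℝ) : ℝ :=
  √(∫ y in (0 : ℝ)..(2 * Real.pi),
    (lam * (3 / 2 * φ (ray (onCircle p y) lam) + scaling φ (ray (onCircle p y) lam)) ^ 2
      + lam ^ 3 * pd 4 φ (ray (onCircle p y) lam) ^ 2))

/-- `A_{tx}(λ)`. -/
def A (χ : ℝ → ℝ) (M : ℝ) (N : SphereFrame) (H : TensorField) (p : Spacetime) (lam : ℝ) : ℝ :=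
  (⨆ y : ℝ, |lam⁻¹ * scaling (fun q => (q 0 / hypTime q) ^ 2 * cSum N (flatH1 χ M H) 0 0 q)
      (ray (onCircle p y) lam)|)
  + (⨆ y : ℝ, |lam⁻¹ * scaling (flatH1 χ M H 4 4) (ray (onCircle p y) lam)|)
  + (⨆ y : ℝ, |lam⁻¹ * (fun q => χ (radius q / q 0) * deriv χ (radius q)
      * (q 0 / hypTime q) ^ 2 * M) (ray (onCircle p y) lam)|)

/-- `B_{tx}(λ)`. -/
def B (χ : ℝ → ℝ) (M : ℝ) (N : SphereFrame) (H : TensorField) (φ F : Spacetime → ℝ)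
    (p : Spacetime) (lam : ℝ) : ℝ :=
  √(∫ y in (0 : ℝ)..(2 * Real.pi),
    lam⁻¹ * remainder χ M N H φ F (ray (onCircle p y) lam) ^ 2)

end KaluzaKlein

end

/-!
The estimate is an energy inequality for a wave equation in the two variables `(λ, y)`, obtained by
restricting everything to the rays `λ ↦ (λ t / s, λ x / s, y)`, on which `λ d/dλ = 𝒮`
(`hasDerivAt_ray`) and the hyperbolic time `s` equals `λ`.

*Reduction to the rays.* In the hyperbolic frame the flat wave operator is `s² □ = -P + s² ∂_y² + R₀`
with `P φ = 𝒮²φ + 2 𝒮φ + 3/4 φ` (`scalingOp`), and `s² ∂_t² = (t/s)² (P - Q)`. The tensor components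
in the null frame only enter through contractions that do not depend on the frame
(`sum_upperComp`), so the equation for `φ` becomes (`remainder_eq`)
`R[φ] = α Pφ - s² β ∂_y² φ - t (c^{04} + c^{40}) ∂_y (3/2 φ + 𝒮φ)`, where
`α = 1 + a (t² + r²) / s² - (t/s)² (H^{1,UV})^♭ c_{UV}^{00}` and `β = 1 + (H^{1,44})^♭`
do not depend on `y`. For `v = λ^{1/2} (3/2 φ + 𝒮φ)` and `z = λ^{3/2} ∂_y φ` this is the symmetric
system `α v_λ = β z_y + κ v_y + λ^{-1/2} R[φ]`, `z_λ = v_y`.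

*Energy.* The derivative of `∫ (α v² + β z²) dy` contains no second derivatives of `φ` beyond the
remainder, since the fluxes are exact in `y` and the coefficients are constant along the circles
(`energy_inequality`). What is left is `α'`, `β'` and the source, and Grönwall's inequality applies.

*Coefficients.* The covector `(1, -x/t, 0)` of `c^{00}` is `-L_♭` up to `O(s²/t²)`, so the assumption on
the `LL` component bounds `(t/s)² (H^{1,UV})^♭ c_{UV}^{00}` (`abs_cSum_zero_zero_le`). In the interior
region `χ(r) = 1` on the support of `χ(r/t)`; hence the tail contributes to `α` a term
`const / λ` with a nonnegative constant (`tail_rayMap`), which is bounded because `s² ≥ 2 t`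
(`tail_mul_le`), and whose derivative has a favourable sign. The last supremum in `A` vanishes for
the same reason.

*Conclusion.* As `φ` has zero average, Poincaré's inequality on the circle bounds `φ` by `∂_y φ`, and
so the energy controls all three norms (`norms_le_Y`).
-/

noncomputable section

namespace KaluzaKlein

open Set Filter Topology

/-! ### Calculus of the coordinate and hyperbolic derivatives -/

lemma spat_zero : spat 0 = 1 := rfl
lemma spat_one : spat 1 = 2 := rfl
lemma spat_two : spat 2 = 3 := rfl

lemma pd_add {f g : Spacetime → ℝ} {p : Spacetime} (μ : Fin 5) (hf : DifferentiableAt ℝ f p)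
    (hg : DifferentiableAt ℝ g p) : pd μ (fun q => f q + g q) p = pd μ f p + pd μ g p := by
  simp only [pd]
  rw [fderiv_fun_add hf hg]; rfl

lemma pd_sum {ι : Type*} (u : Finset ι) {f : ι → Spacetime → ℝ} {p : Spacetime} (μ : Fin 5)
    (hf : ∀ i ∈ u, DifferentiableAt ℝ (f i) p) :
    pd μ (fun q => ∑ i ∈ u, f i q) p = ∑ i ∈ u, pd μ (f i) p := by
  simp only [pd]
  rw [fderiv_fun_sum hf]; simp

lemma pd_mul {f g : Spacetime → ℝ} {p : Spacetime} (μ : Fin 5) (hf : DifferentiableAt ℝ f p)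
    (hg : DifferentiableAt ℝ g p) :
    pd μ (fun q => f q * g q) p = pd μ f p * g p + f p * pd μ g p := by
  simp only [pd]
  rw [fderiv_fun_mul hf hg]
  simp only [add_apply, smul_apply, smul_eq_mul]; ring

lemma pd_coord (μ ν : Fin 5) (p : Spacetime) :
    pd μ (fun q => q ν) p = if ν = μ then 1 else 0 := by
  have : HasFDerivAt (fun q : Spacetime => q ν) (ContinuousLinearMap.proj (R := ℝ) ν) p :=
    (ContinuousLinearMap.proj (R := ℝ) (φ := fun _ : Fin 5 => ℝ) ν).hasFDerivAt
  simp [pd, this.fderiv, Pi.single_apply]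

lemma contDiffAt_pd {φ : Spacetime → ℝ} {p : Spacetime} (h : ContDiffAt ℝ 2 φ p)
    (μ : Fin 5) : ContDiffAt ℝ 1 (pd μ φ) p :=
  (h.fderiv_right (m := 1) (by norm_num)).clm_apply contDiffAt_const

lemma pd_comm {φ : Spacetime → ℝ} {p : Spacetime} (h : ContDiffAt ℝ 2 φ p) (μ ν : Fin 5) :
    pd μ (pd ν φ) p = pd ν (pd μ φ) p := by
  have hd : DifferentiableAt ℝ (fderiv ℝ φ) p :=
    (h.fderiv_right (m := 1) (by norm_num)).differentiableAt (by norm_num)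
  have key : ∀ μ ν : Fin 5, pd μ (pd ν φ) p
      = fderiv ℝ (fderiv ℝ φ) p (Pi.single μ 1) (Pi.single ν 1) := by
    intro μ ν
    change fderiv ℝ (fun q => fderiv ℝ φ q (Pi.single ν 1)) p (Pi.single μ 1) = _
    rw [fderiv_clm_apply hd (differentiableAt_const _)]
    simp
  rw [key, key]
  exact (h.isSymmSndFDerivAt (by simp)).eq _ _

/-- The coefficient of `∂_t` in `∂̲_ν - ∂_ν`: `x^a / t` for `ν = a`, and `0` for `ν = 0, 4`. -/
def hypCoef (ν : Fin 5) (p : Spacetime) : ℝ := if ν = 0 ∨ ν = 4 then 0 else p ν / p 0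

/-- The derivative `∂_μ` of `hypCoef ν`, in closed form. -/
def hypCoefDeriv (μ ν : Fin 5) (p : Spacetime) : ℝ :=
  if ν = 0 ∨ ν = 4 then 0
  else (if ν = μ then 1 else 0) / p 0 - (if 0 = μ then 1 else 0) * p ν / p 0 ^ 2

lemma hd_eq (μ : Fin 5) (f : Spacetime → ℝ) (p : Spacetime) :
    hd μ f p = pd μ f p + hypCoef μ p * pd 0 f p := by
  unfold hd hypCoef; split_ifs <;> simp

lemma contDiffAt_coord (n : WithTop ℕ∞) (ν : Fin 5) (p : Spacetime) :
    ContDiffAt ℝ n (fun q : Spacetime => q ν) p :=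
  (contDiff_apply ℝ ℝ ν).contDiffAt

lemma contDiffAt_hypCoef (n : WithTop ℕ∞) (ν : Fin 5) {p : Spacetime} (hp : p 0 ≠ 0) :
    ContDiffAt ℝ n (hypCoef ν) p := by
  unfold hypCoef
  split_ifs
  · exact contDiffAt_const
  · exact (contDiffAt_coord n ν p).div (contDiffAt_coord n 0 p) hp

lemma pd_hypCoef (μ ν : Fin 5) {p : Spacetime} (hp : p 0 ≠ 0) :
    pd μ (hypCoef ν) p = hypCoefDeriv μ ν p := by
  unfold hypCoef hypCoefDeriv
  split_ifs with h
  · simp [pd]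
  all_goals
    have hx : ∀ i, DifferentiableAt ℝ (fun q : Spacetime => q i) p := fun i =>
      (contDiffAt_coord 1 i p).differentiableAt (by norm_num)
    have hi : pd μ (fun q => (q 0)⁻¹) p = -(p 0 ^ 2)⁻¹ * pd μ (fun q => q 0) p := by
      have h1 := (hasDerivAt_inv hp).comp_hasFDerivAt p (hx 0).hasFDerivAt
      have h2 : HasFDerivAt (fun q : Spacetime => (q 0)⁻¹) _ p := h1
      rw [pd, h2.fderiv]; rfl
    simp only [div_eq_mul_inv]
    rw [pd_mul μ (hx ν) ((hx 0).fun_inv hp), hi, pd_coord, pd_coord]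
    simp [*]
    try ring

lemma pd_hd {φ : Spacetime → ℝ} {p : Spacetime} (h : ContDiffAt ℝ 2 φ p)
    (hp : p 0 ≠ 0) (μ ν : Fin 5) :
    pd μ (hd ν φ) p = pd μ (pd ν φ) p
      + (hypCoefDeriv μ ν p * pd 0 φ p + hypCoef ν p * pd μ (pd 0 φ) p) := by
  have e : hd ν φ = fun q => pd ν φ q + hypCoef ν q * pd 0 φ q := funext (hd_eq ν φ)
  have h1 := (contDiffAt_pd h ν).differentiableAt (by norm_num)
  have h0 := (contDiffAt_pd h 0).differentiableAt (by norm_num)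
  have hc := (contDiffAt_hypCoef 1 ν hp).differentiableAt (by norm_num)
  rw [e, pd_add μ h1 (hc.fun_mul h0), pd_mul μ hc h0, pd_hypCoef μ ν hp]

lemma contDiffAt_scaling {φ : Spacetime → ℝ} {p : Spacetime} (h : ContDiffAt ℝ 2 φ p) :
    ContDiffAt ℝ 1 (scaling φ) p :=
  ((contDiffAt_coord 1 0 p).mul (contDiffAt_pd h 0)).add
    (ContDiffAt.sum fun a _ => (contDiffAt_coord 1 (spat a) p).mul (contDiffAt_pd h (spat a)))

lemma pd_scaling {φ : Spacetime → ℝ} {p : Spacetime} (h : ContDiffAt ℝ 2 φ p) (μ : Fin 5) :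
    pd μ (scaling φ) p = (if 0 = μ then 1 else 0) * pd 0 φ p + p 0 * pd μ (pd 0 φ) p
      + ∑ a, ((if spat a = μ then 1 else 0) * pd (spat a) φ p
        + p (spat a) * pd μ (pd (spat a) φ) p) := by
  have hx : ∀ ν, DifferentiableAt ℝ (fun q : Spacetime => q ν) p := fun ν =>
    (contDiffAt_coord 1 ν p).differentiableAt (by norm_num)
  have hD : ∀ ν, DifferentiableAt ℝ (pd ν φ) p := fun ν =>
    (contDiffAt_pd h ν).differentiableAt (by norm_num)
  have e : scaling φ = fun q => q 0 * pd 0 φ q + ∑ a : Fin 3, q (spat a) * pd (spat a) φ q := rfl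
  rw [e, pd_add μ ((hx 0).fun_mul (hD 0))
    (DifferentiableAt.fun_sum fun a _ => (hx (spat a)).fun_mul (hD (spat a))),
    pd_mul μ (hx 0) (hD 0), pd_coord, pd_sum _ μ fun a _ => (hx (spat a)).fun_mul (hD (spat a))]
  simp only [pd_mul μ (hx _) (hD _), pd_coord]

lemma pd_four_scaling {φ : Spacetime → ℝ} {p : Spacetime} (h : ContDiffAt ℝ 2 φ p) :
    pd 4 (scaling φ) p = scaling (pd 4 φ) p := by
  rw [pd_scaling h]
  simp only [scaling, Fin.sum_univ_three, spat_zero, spat_one, spat_two, pd_comm h 4]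
  simp

/-! ### The wave equation along the rays -/

/-- `𝒮²φ + 2𝒮φ + 3/4 φ`, the derivative `λ^{1/2} d/dλ (λ^{1/2} (3/2 φ + 𝒮φ))` along a ray. -/
def scalingOp (φ : Spacetime → ℝ) (p : Spacetime) : ℝ :=
  scaling (scaling φ) p + 2 * scaling φ p + 3 / 4 * φ p

lemma radius_sq (p : Spacetime) : radius p ^ 2 = p 1 ^ 2 + p 2 ^ 2 + p 3 ^ 2 := by
  rw [radius, Real.sq_sqrt (Finset.sum_nonneg fun _ _ => sq_nonneg _)]
  simp [Fin.sum_univ_three, spat_zero, spat_one, spat_two]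

lemma hypTime_sq {p : Spacetime} (hp : 0 < hypTime p) :
    hypTime p ^ 2 = p 0 ^ 2 - (p 1 ^ 2 + p 2 ^ 2 + p 3 ^ 2) := by
  rw [← radius_sq]
  exact Real.sq_sqrt (Real.sqrt_pos.mp hp).le

/-- The flat wave operator in the hyperbolic frame: its part transversal to the hyperboloids is
`-𝒮² - 2𝒮`, up to the factor `s²`. -/
lemma sq_mul_waveOp {φ : Spacetime → ℝ} {p : Spacetime} (h : ContDiffAt ℝ 2 φ p) (hp : p 0 ≠ 0)
    (hs : 0 < hypTime p) :
    hypTime p ^ 2 * waveOp φ p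
      = R0 φ p - scalingOp φ p + hypTime p ^ 2 * pd 4 (pd 4 φ) p := by
  have e : hypTime p ^ 2 * (-pd 0 (pd 0 φ) p + pd 1 (pd 1 φ) p + pd 2 (pd 2 φ) p
      + pd 3 (pd 3 φ) p) = R0 φ p - scalingOp φ p := by
    simp only [R0, scalingOp, hypLap, xxHd, xHd]
    rw [hypTime_sq hs]
    unfold scaling
    change _ = _ - (p 0 * pd 0 (scaling φ) p + ∑ a : Fin 3, p (spat a) * pd (spat a) (scaling φ) p
      + _ + _)
    simp only [hd_eq, pd_hd h hp, pd_scaling h, Fin.sum_univ_three, spat_zero, spat_one, spat_two]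
    simp only [hypCoef, hypCoefDeriv]
    simp
    rw [pd_comm h 1 0, pd_comm h 2 0, pd_comm h 3 0, pd_comm h 2 1, pd_comm h 3 1, pd_comm h 3 2]
    field_simp
    ring
  have e2 : waveOp φ p = (-pd 0 (pd 0 φ) p + pd 1 (pd 1 φ) p + pd 2 (pd 2 φ) p
      + pd 3 (pd 3 φ) p) + pd 4 (pd 4 φ) p := by
    simp only [waveOp, Fin.sum_univ_four]
    change -pd 0 (pd 0 φ) p + (pd 1 (pd 1 φ) p + pd 2 (pd 2 φ) p + pd 3 (pd 3 φ) p
      + pd 4 (pd 4 φ) p) = _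
    ring
  rw [e2, mul_add, e]

/-- `s² ∂_t²` in terms of the scaling field: `Q` collects the terms with a derivative tangent to
the hyperboloid. -/
lemma sq_mul_pd_zero_zero {φ : Spacetime → ℝ} {p : Spacetime} (h : ContDiffAt ℝ 2 φ p)
    (hp : p 0 ≠ 0) (hs : 0 < hypTime p) :
    hypTime p ^ 2 * pd 0 (pd 0 φ) p = (p 0 / hypTime p) ^ 2 * (scalingOp φ p - Q φ p) := by
  have e : hypTime p ^ 4 * pd 0 (pd 0 φ) p = p 0 ^ 2 * (scalingOp φ p - Q φ p) := by
    have hQ : Q φ p = 3 / 4 * φ p +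
        (hypTime p ^ 2 * (2 * (∑ a, p (spat a) / p 0 * hd (spat a) (pd 0 φ) p)
          - radius p ^ 2 / p 0 ^ 3 * pd 0 φ p + 3 / p 0 * pd 0 φ p)
          + xxHd φ p + 3 * xHd φ p) := by
      unfold Q; field_simp; ring
    rw [hQ, show hypTime p ^ 4 = (hypTime p ^ 2) ^ 2 by ring, radius_sq, hypTime_sq hs]
    simp only [scalingOp, xxHd, xHd]
    unfold scaling
    change _ = _ * ((p 0 * pd 0 (scaling φ) p
      + ∑ a : Fin 3, p (spat a) * pd (spat a) (scaling φ) p + _ + _) - _)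
    simp only [hd_eq, pd_hd h hp, pd_scaling h, Fin.sum_univ_three, spat_zero, spat_one, spat_two]
    simp only [hypCoef, hypCoefDeriv]
    simp
    rw [pd_comm h 1 0, pd_comm h 2 0, pd_comm h 3 0, pd_comm h 2 1, pd_comm h 3 1, pd_comm h 3 2]
    field_simp
    ring
  field_simp
  linear_combination e

/-- The contribution of `H⁰`. -/
lemma sq_mul_schwarzschild {φ : Spacetime → ℝ} {p : Spacetime} (χ : ℝ → ℝ) (M : ℝ)
    (h : ContDiffAt ℝ 2 φ p) (hp : p 0 ≠ 0) (hs : 0 < hypTime p) :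
    hypTime p ^ 2 * ∑ μ, ∑ ν, schwarzschildPart χ M μ ν p * pd μ (pd ν φ) p
      = R01 χ M φ p + R02 χ M φ p
        - tail χ M p * ((p 0 ^ 2 + radius p ^ 2) / hypTime p ^ 2) * scalingOp φ p := by
  -- `∂_t² + Δ_x` is `(1 + r²/t²) ∂_t²` up to the operators of `R01`
  have e : pd 0 (pd 0 φ) p + pd 1 (pd 1 φ) p + pd 2 (pd 2 φ) p + pd 3 (pd 3 φ) p
      = (p 0 ^ 2 + radius p ^ 2) / p 0 ^ 2 * pd 0 (pd 0 φ) p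
        - ((∑ a, p (spat a) / p 0 * pd 0 (hd (spat a) φ) p)
          + (∑ a, p (spat a) / p 0 * hd (spat a) (pd 0 φ) p)
          - hypLap φ p + 3 / p 0 * pd 0 φ p) := by
    rw [radius_sq]
    simp only [hypLap, hd_eq, pd_hd h hp, Fin.sum_univ_three, spat_zero, spat_one, spat_two]
    simp only [hypCoef, hypCoefDeriv]
    simp
    rw [pd_comm h 1 0, pd_comm h 2 0, pd_comm h 3 0]
    field_simp
    ring
  have e2 : ∑ μ, ∑ ν, schwarzschildPart χ M μ ν p * pd μ (pd ν φ) p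
      = -tail χ M p * (pd 0 (pd 0 φ) p + pd 1 (pd 1 φ) p + pd 2 (pd 2 φ) p
        + pd 3 (pd 3 φ) p) := by
    simp [schwarzschildPart, Fin.sum_univ_five]
    ring
  have e3 := sq_mul_pd_zero_zero h hp hs
  rw [e2, e, R01, R02]
  have e4 : pd 0 (pd 0 φ) p = (p 0 / hypTime p) ^ 2 * (scalingOp φ p - Q φ p) / hypTime p ^ 2 := by
    rw [← e3]; field_simp
  rw [e4]
  field_simp
  ring

/-- `s² ∂_t ∂_y` in terms of the scaling field. -/
lemma sq_mul_pd_zero_four {φ : Spacetime → ℝ} {p : Spacetime} (h : ContDiffAt ℝ 2 φ p)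
    (hp : p 0 ≠ 0) (hs : 0 < hypTime p) :
    hypTime p ^ 2 * pd 0 (pd 4 φ) p = p 0 * (3 / 2 * pd 4 φ p + pd 4 (scaling φ) p)
      - p 0 * (3 / 2 * pd 4 φ p + ∑ a, p (spat a) * pd 4 (hd (spat a) φ) p) := by
  rw [hypTime_sq hs]
  simp only [pd_hd h hp, pd_scaling h, Fin.sum_univ_three, spat_zero, spat_one, spat_two]
  simp only [hypCoef, hypCoefDeriv]
  simp
  rw [pd_comm h 4 0]
  field_simp
  ring

/-! ### The null frame -/

/-- The null frame resolves the identity, `ḡ^{UU'} U^μ U'_ρ = δ^μ_ρ`: this holds for any orthonormal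
frame `e`, whose transpose is orthonormal too. -/
lemma nullVec_resolution (N : SphereFrame) (p : Spacetime) (μ ρ : Fin 5) :
    ∑ U, ∑ U', nullInv U U' * nullVec N U p μ * lowerIdx (nullVec N U' p) ρ
      = if μ = ρ then 1 else 0 := by
  set x : Fin 3 → ℝ := fun a => p (spat a) with hx
  have hE : (Matrix.of fun i a => N.e i x a) * (Matrix.of fun i a => N.e i x a).transpose = 1 := by
    ext i j
    simp [Matrix.mul_apply, Matrix.one_apply, N.orthonormal x i j]
  have hT : ∀ a b, N.e 0 x a * N.e 0 x b + N.e 1 x a * N.e 1 x b + N.e 2 x a * N.e 2 x b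
      = if a = b then 1 else 0 := by
    intro a b
    have := congrArg (fun m : Matrix (Fin 3) (Fin 3) ℝ => m a b) (mul_eq_one_comm.mp hE)
    simpa [Matrix.mul_apply, Matrix.one_apply, Fin.sum_univ_three] using this
  have h00 := hT 0 0
  have h01 := hT 0 1
  have h02 := hT 0 2
  have h11 := hT 1 1
  have h12 := hT 1 2
  have h22 := hT 2 2
  simp at h00 h01 h02 h11 h12 h22
  fin_cases μ <;> fin_cases ρ <;>
    simp [Fin.sum_univ_five, nullInv, nullVec, lowerIdx, ← hx] <;> linarith

/-- `π^{UV} U^μ V^ν = π^{μν}`, whichever sphere frame is chosen. -/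
lemma sum_upperComp (N : SphereFrame) (T : TensorField) (p : Spacetime) (μ ν : Fin 5) :
    ∑ U, ∑ V, upperComp N T U V p * (nullVec N U p μ * nullVec N V p ν) = T μ ν p := by
  have h := nullVec_resolution N p
  calc ∑ U, ∑ V, upperComp N T U V p * (nullVec N U p μ * nullVec N V p ν)
      = ∑ U, ∑ V, ∑ U', ∑ V', ∑ ρ, ∑ σ, T ρ σ p
          * ((nullInv U U' * nullVec N U p μ * lowerIdx (nullVec N U' p) ρ)
          * (nullInv V V' * nullVec N V p ν * lowerIdx (nullVec N V' p) σ)) := by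
        simp only [upperComp, lowerComp, Finset.sum_mul, Finset.mul_sum]
        refine Finset.sum_congr rfl fun _ _ => Finset.sum_congr rfl fun _ _ =>
          Finset.sum_congr rfl fun _ _ => Finset.sum_congr rfl fun _ _ =>
          Finset.sum_congr rfl fun _ _ => Finset.sum_congr rfl fun _ _ => by ring
    _ = ∑ ρ, ∑ σ, T ρ σ p
          * ((∑ U, ∑ U', nullInv U U' * nullVec N U p μ * lowerIdx (nullVec N U' p) ρ)
          * (∑ V, ∑ V', nullInv V V' * nullVec N V p ν * lowerIdx (nullVec N V' p) σ)) := by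
        simp only [Finset.sum_mul_sum]
        simp only [Finset.mul_sum]
        simp only [← Finset.sum_product']
        refine Finset.sum_equiv
          ⟨fun i => (i.2.2.2.2.1, i.2.2.2.2.2, i.1, i.2.1, i.2.2.1, i.2.2.2.1),
           fun i => (i.2.2.1, i.2.2.2.1, i.2.2.2.2.1, i.2.2.2.2.2, i.1, i.2.1),
           fun _ => rfl, fun _ => rfl⟩ (by simp) fun _ _ => rfl
    _ = T μ ν p := by simp [h]

/-- Contraction of a tensor in the null frame with coefficients `G_μν U^μ V^ν`. -/
lemma sum_upperComp_mul (N : SphereFrame) (T : TensorField) (p : Spacetime)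
    (G : Fin 5 → Fin 5 → ℝ) :
    ∑ U, ∑ V, upperComp N T U V p * (∑ μ, ∑ ν, nullVec N U p μ * nullVec N V p ν * G μ ν)
      = ∑ μ, ∑ ν, T μ ν p * G μ ν := by
  simp only [← sum_upperComp N T p, Finset.sum_mul, Finset.mul_sum]
  simp only [← Finset.sum_product']
  refine Finset.sum_equiv
    ⟨fun i => (i.2.2.1, i.2.2.2, i.1, i.2.1), fun i => (i.2.2.1, i.2.2.2, i.1, i.2.1),
      fun _ => rfl, fun _ => rfl⟩ (by simp) fun _ _ => ?_
  simp only [Equiv.coe_fn_mk]; ring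

lemma cSum_eq (N : SphereFrame) (T : TensorField) (α β : Fin 5) (p : Spacetime) :
    cSum N T α β p = ∑ μ, ∑ ν, T μ ν p * (hypTrans μ α p * hypTrans ν β p) := by
  rw [← sum_upperComp_mul N, cSum]
  simp only [cCoef, Finset.sum_mul_sum]
  simp only [mul_mul_mul_comm]

lemma dSum_eq (N : SphereFrame) (T : TensorField) (γ : Fin 5) (p : Spacetime) :
    dSum N T γ p = ∑ μ, ∑ ν, T μ ν p * pd μ (hypTrans ν γ) p :=
  sum_upperComp_mul N T p fun μ ν => pd μ (hypTrans ν γ) p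

lemma hypTrans_eq (μ α : Fin 5) (p : Spacetime) :
    hypTrans μ α p = (if μ = α then 1 else 0) - if α = 0 then hypCoef μ p else 0 := by
  unfold hypTrans hypCoef
  fin_cases μ <;> fin_cases α <;> simp

lemma pd_hypTrans (μ ν γ : Fin 5) {p : Spacetime} (hp : p 0 ≠ 0) :
    pd μ (hypTrans ν γ) p = - if γ = 0 then hypCoefDeriv μ ν p else 0 := by
  have : hypTrans ν γ = fun q => (if ν = γ then 1 else 0) - if γ = 0 then hypCoef ν q else 0 :=
    funext (hypTrans_eq ν γ)
  rw [this]
  by_cases h : γ = 0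
  · simp only [h, if_true, pd, fderiv_const_sub]
    rw [← pd_hypCoef μ ν hp]; rfl
  · simp [h, pd]

/-- `∂_μ ∂_ν` in the hyperbolic frame. -/
lemma pd_pd_eq {φ : Spacetime → ℝ} {p : Spacetime} (h : ContDiffAt ℝ 2 φ p) (hp : p 0 ≠ 0)
    (μ ν : Fin 5) :
    (∑ α, ∑ β, hypTrans μ α p * hypTrans ν β p * hd α (hd β φ) p)
      + ∑ γ, pd μ (hypTrans ν γ) p * hd γ φ p = pd μ (pd ν φ) p := by
  have c0 : hypCoef 0 p = 0 := by simp [hypCoef]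
  have d0 : ∀ α, hypCoefDeriv α 0 p = 0 := fun α => by simp [hypCoefDeriv]
  have e : ∀ (ν : Fin 5) (X : Fin 5 → ℝ), ∑ β, hypTrans ν β p * X β = X ν - hypCoef ν p * X 0 := by
    intro ν X
    simp [hypTrans_eq, sub_mul, Finset.sum_sub_distrib]
  simp only [mul_assoc, ← Finset.mul_sum]
  simp only [e, pd_hypTrans μ ν _ hp]
  simp only [neg_mul, ite_mul, zero_mul, Finset.sum_neg_distrib, Finset.sum_ite_eq',
    Finset.mem_univ, if_true, hd_eq, pd_hd h hp, c0, d0]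
  ring

/-- The decomposition of `π^{μν} ∂_μ ∂_ν` behind `R11`, `R12` and `R13`. -/
lemma sq_mul_tensor {φ : Spacetime → ℝ} {p : Spacetime} (N : SphereFrame) (T : TensorField)
    (h : ContDiffAt ℝ 2 φ p) (hp : p 0 ≠ 0) (hs : 0 < hypTime p) :
    hypTime p ^ 2 * ∑ μ, ∑ ν, T μ ν p * pd μ (pd ν φ) p
      = R11 N T φ p + R12 N T φ p + R13 N T φ p
        + (p 0 / hypTime p) ^ 2 * cSum N T 0 0 p * scalingOp φ p
        + p 0 * (cSum N T 0 4 p + cSum N T 4 0 p) * (3 / 2 * pd 4 φ p + pd 4 (scaling φ) p)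
        + hypTime p ^ 2 * T 4 4 p * pd 4 (pd 4 φ) p := by
  have e1 : ∑ μ, ∑ ν, T μ ν p * pd μ (pd ν φ) p
      = (∑ α, ∑ β, cSum N T α β p * hd α (hd β φ) p) + ∑ γ, dSum N T γ p * hd γ φ p := by
    simp only [cSum_eq, dSum_eq, ← pd_pd_eq h hp, mul_add, Finset.sum_add_distrib,
      Finset.sum_mul, Finset.mul_sum]
    congr 1
    · simp only [← Finset.sum_product']
      refine Finset.sum_equiv
        ⟨fun i => (i.2.2.1, i.2.2.2, i.1, i.2.1), fun i => (i.2.2.1, i.2.2.2, i.1, i.2.1),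
          fun _ => rfl, fun _ => rfl⟩ (by simp) fun _ _ => ?_
      simp only [Equiv.coe_fn_mk]; ring
    · simp only [← Finset.sum_product']
      refine Finset.sum_equiv
        ⟨fun i => (i.2.2, i.1, i.2.1), fun i => (i.2.1, i.2.2, i.1),
          fun _ => rfl, fun _ => rfl⟩ (by simp) fun _ _ => ?_
      simp only [Equiv.coe_fn_mk]; ring
  have e2 : ∑ α, ∑ β, cSum N T α β p * hd α (hd β φ) p
      = (∑ α, ∑ β, if (α ≠ 0 ∧ α ≠ 4) ∨ (β ≠ 0 ∧ β ≠ 4) then cSum N T α β p * hd α (hd β φ) p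
          else 0)
        + (cSum N T 0 0 p * hd 0 (hd 0 φ) p + cSum N T 0 4 p * hd 0 (hd 4 φ) p
          + cSum N T 4 0 p * hd 4 (hd 0 φ) p + cSum N T 4 4 p * hd 4 (hd 4 φ) p) := by
    simp [Fin.sum_univ_five]
    ring
  have e3 : cSum N T 4 4 p = T 4 4 p := by
    rw [cSum_eq]
    simp [hypTrans_eq]
  have e4 : hd 0 (hd 0 φ) p = pd 0 (pd 0 φ) p ∧ hd 0 (hd 4 φ) p = pd 0 (pd 4 φ) p ∧
      hd 4 (hd 0 φ) p = pd 0 (pd 4 φ) p ∧ hd 4 (hd 4 φ) p = pd 4 (pd 4 φ) p := by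
    simp [hd_eq, pd_hd h hp, hypCoef, hypCoefDeriv, pd_comm h 4 0]
  rw [e1, e2, e3, e4.1, e4.2.1, e4.2.2.1, e4.2.2.2, R11, R12, R13]
  have e5 := sq_mul_pd_zero_zero h hp hs
  have e6 := sq_mul_pd_zero_four h hp hs
  have e7 : p 0 / hypTime p * hypTime p = p 0 := by field_simp
  linear_combination cSum N T 0 0 p * e5 + (cSum N T 0 4 p + cSum N T 4 0 p) * e6
    + (cSum N T 0 4 p + cSum N T 4 0 p)
      * (3 / 2 * pd 4 φ p + ∑ a, p (spat a) * pd 4 (hd (spat a) φ) p) * e7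

/-- The wave equation as an evolution equation along the rays. -/
lemma remainder_eq {χ : ℝ → ℝ} {M : ℝ} (N : SphereFrame) {H : TensorField} {φ F : Spacetime → ℝ}
    {p : Spacetime} (h : ContDiffAt ℝ 2 φ p) (hp : p 0 ≠ 0) (hs : 0 < hypTime p)
    (hH : ∀ μ ν, flat (H μ ν) p = schwarzschildPart χ M μ ν p + flatH1 χ M H μ ν p)
    (heq : waveOp φ p + ∑ μ, ∑ ν, flat (H μ ν) p * pd μ (pd ν φ) p = F p) :
    remainder χ M N H φ F p
      = (1 + tail χ M p * ((p 0 ^ 2 + radius p ^ 2) / hypTime p ^ 2)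
          - (p 0 / hypTime p) ^ 2 * cSum N (flatH1 χ M H) 0 0 p) * scalingOp φ p
        - hypTime p ^ 2 * (1 + flatH1 χ M H 4 4 p) * pd 4 (pd 4 φ) p
        - p 0 * (cSum N (flatH1 χ M H) 0 4 p + cSum N (flatH1 χ M H) 4 0 p)
          * (3 / 2 * pd 4 φ p + pd 4 (scaling φ) p) := by
  simp only [hH, add_mul, Finset.sum_add_distrib] at heq
  rw [remainder, ← heq]
  have h1 := sq_mul_waveOp h hp hs
  have h2 := sq_mul_schwarzschild χ M h hp hs
  have h3 := sq_mul_tensor N (flatH1 χ M H) h hp hs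
  linear_combination -h1 - h2 - h3

/-! ### Geometry of the interior region and of the rays -/

lemma mem_interiorRegion_iff {p : Spacetime} :
    p ∈ interiorRegion ↔ 1 ≤ p 0 ∧ 2 * p 0 ≤ p 0 ^ 2 - radius p ^ 2 := by
  change 1 + √(1 + radius p ^ 2) ≤ p 0 ↔ _
  constructor
  · intro h
    have h1 : √(1 + radius p ^ 2) ≤ p 0 - 1 := by linarith
    have h2 := Real.sqrt_nonneg (1 + radius p ^ 2)
    have h3 := (Real.sqrt_le_left (by linarith)).mp h1
    exact ⟨by linarith, by linarith⟩
  · rintro ⟨h1, h2⟩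
    have : √(1 + radius p ^ 2) ≤ p 0 - 1 := (Real.sqrt_le_left (by linarith)).mpr (by linarith)
    linarith

lemma radius_nonneg (p : Spacetime) : 0 ≤ radius p := Real.sqrt_nonneg _

lemma two_le_of_mem {p : Spacetime} (h : p ∈ interiorRegion) : 2 ≤ p 0 := by
  obtain ⟨h1, h2⟩ := mem_interiorRegion_iff.mp h
  nlinarith [sq_nonneg (radius p)]

lemma hypTime_sq_of_mem {p : Spacetime} (h : p ∈ interiorRegion) :
    hypTime p ^ 2 = p 0 ^ 2 - radius p ^ 2 := by
  obtain ⟨h1, h2⟩ := mem_interiorRegion_iff.mp h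
  exact Real.sq_sqrt (by linarith)

lemma hypTime_pos_of_mem {p : Spacetime} (h : p ∈ interiorRegion) : 0 < hypTime p := by
  obtain ⟨h1, h2⟩ := mem_interiorRegion_iff.mp h
  exact Real.sqrt_pos.mpr (by linarith)

lemma two_mul_le_hypTime_sq {p : Spacetime} (h : p ∈ interiorRegion) :
    2 * p 0 ≤ hypTime p ^ 2 := by
  rw [hypTime_sq_of_mem h]; exact (mem_interiorRegion_iff.mp h).2

lemma radius_lt_of_mem {p : Spacetime} (h : p ∈ interiorRegion) : radius p < p 0 := by
  obtain ⟨h1, h2⟩ := mem_interiorRegion_iff.mp h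
  nlinarith [radius_nonneg p]

lemma spat_ne_four (a : Fin 3) : spat a ≠ 4 := by fin_cases a <;> decide

lemma onCircle_apply_of_ne {μ : Fin 5} (h : μ ≠ 4) (p : Spacetime) (y : ℝ) :
    onCircle p y μ = p μ := Function.update_of_ne h _ _

lemma onCircle_zero (p : Spacetime) (y : ℝ) : onCircle p y 0 = p 0 :=
  onCircle_apply_of_ne (by decide) p y

lemma radius_onCircle (p : Spacetime) (y : ℝ) : radius (onCircle p y) = radius p := by
  simp only [radius, onCircle_apply_of_ne (spat_ne_four _)]

lemma hypTime_onCircle (p : Spacetime) (y : ℝ) : hypTime (onCircle p y) = hypTime p := by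
  simp only [hypTime, radius_onCircle, onCircle_zero]

lemma onCircle_onCircle (p : Spacetime) (y z : ℝ) : onCircle (onCircle p y) z = onCircle p z :=
  Function.update_idem _ _ _

lemma flat_onCircle (f : Spacetime → ℝ) (p : Spacetime) (y : ℝ) :
    flat f (onCircle p y) = flat f p := by
  simp only [flat, onCircle_onCircle]

lemma onCircle_mem_hypSlab {s₀ S₀ : ℝ} {p : Spacetime} (h : p ∈ hypSlab s₀ S₀) (y : ℝ) :
    onCircle p y ∈ hypSlab s₀ S₀ := by
  simpa [hypSlab, interiorRegion, hypTime_onCircle, radius_onCircle, onCircle_zero] using h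

lemma ray_onCircle (p : Spacetime) (y lam : ℝ) :
    ray (onCircle p y) lam = onCircle (ray p lam) y := by
  ext μ
  by_cases h : μ = 4
  · subst h; simp [ray, onCircle]
  · simp [ray, h, onCircle_apply_of_ne h, hypTime_onCircle]

lemma ray_apply_of_ne {μ : Fin 5} (h : μ ≠ 4) (p : Spacetime) (lam : ℝ) :
    ray p lam μ = lam * p μ / hypTime p := if_neg h

lemma ray_zero (p : Spacetime) (lam : ℝ) : ray p lam 0 = lam * p 0 / hypTime p :=
  ray_apply_of_ne (by decide) p lam

lemma radius_ray (p : Spacetime) {lam : ℝ} (h : 0 ≤ lam) :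
    radius (ray p lam) = lam * radius p / hypTime p := by
  have h2 : 0 ≤ lam / hypTime p := div_nonneg h (Real.sqrt_nonneg _)
  have : ∑ a : Fin 3, ray p lam (spat a) ^ 2
      = (lam / hypTime p) ^ 2 * ∑ a : Fin 3, p (spat a) ^ 2 := by
    rw [Finset.mul_sum]
    refine Finset.sum_congr rfl fun a _ => ?_
    rw [ray_apply_of_ne (spat_ne_four a)]; ring
  rw [radius, this, Real.sqrt_mul (sq_nonneg _), Real.sqrt_sq h2, radius]
  ring

lemma hypTime_ray {p : Spacetime} (hs : 0 < hypTime p) {lam : ℝ} (h : 0 ≤ lam) :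
    hypTime (ray p lam) = lam := by
  have h1 : hypTime p ^ 2 = p 0 ^ 2 - radius p ^ 2 := Real.sq_sqrt (Real.sqrt_pos.mp hs).le
  have : ray p lam 0 ^ 2 - radius (ray p lam) ^ 2 = lam ^ 2 := by
    rw [ray_zero, radius_ray p h, div_pow, div_pow, mul_pow, mul_pow, ← sub_div, ← mul_sub, ← h1]
    field_simp
  rw [hypTime, this, Real.sqrt_sq h]

lemma ray_hypTime {p : Spacetime} (hs : 0 < hypTime p) : ray p (hypTime p) = p := by
  ext μ
  by_cases h : μ = 4
  · subst h; simp [ray]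
  · rw [ray_apply_of_ne h]; field_simp

/-- The interior region meets a ray in a half-line. -/
lemma ray_mem_interiorRegion {p : Spacetime} (hs : 0 < hypTime p) (hp : 0 < p 0) {lam₀ lam : ℝ}
    (h0 : 0 < lam₀) (h : ray p lam₀ ∈ interiorRegion) (hl : lam₀ ≤ lam) :
    ray p lam ∈ interiorRegion := by
  have hl0 : 0 < lam := h0.trans_le hl
  have h2 := two_mul_le_hypTime_sq h
  have h3 := two_le_of_mem h
  rw [hypTime_ray hs h0.le] at h2
  have hc : 0 < p 0 / hypTime p := div_pos hp hs
  have e : ∀ x, ray p x 0 = x * (p 0 / hypTime p) := fun x => by rw [ray_zero]; ring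
  rw [e] at h2 h3
  have e2 : ray p lam 0 ^ 2 - radius (ray p lam) ^ 2 = lam ^ 2 := by
    have h5 := hypTime_ray hs hl0.le
    have h6 : 0 < hypTime (ray p lam) := by rw [h5]; exact hl0
    rw [← Real.sq_sqrt (Real.sqrt_pos.mp h6).le]
    exact congrArg (· ^ 2) h5
  rw [mem_interiorRegion_iff, e2, e]
  have h4 : 2 * (p 0 / hypTime p) ≤ lam₀ := by
    by_contra hcon
    push Not at hcon
    nlinarith
  constructor
  · nlinarith
  · nlinarith

/-- The ray through `(t, x)` and the circle over it, parametrised by `(λ, y)`. -/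
def rayMap (p : Spacetime) (q : ℝ × ℝ) : Spacetime := ray (onCircle p q.2) q.1

lemma rayMap_mem_hypSlab {s₀ S₀ : ℝ} (hs₀ : 2 ≤ s₀) {p : Spacetime} (hp : p ∈ hypSlab s₀ S₀)
    {lam₀ lam : ℝ} (h0 : s₀ ≤ lam₀) (h : ray p lam₀ ∈ interiorRegion) (hl : lam₀ ≤ lam)
    (hl' : lam ≤ hypTime p) (y : ℝ) : rayMap p (lam, y) ∈ hypSlab s₀ S₀ := by
  have hs := hypTime_pos_of_mem hp.1
  rw [rayMap, ray_onCircle]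
  apply onCircle_mem_hypSlab
  refine ⟨ray_mem_interiorRegion hs (by linarith [two_le_of_mem hp.1]) (by linarith) h hl, ?_⟩
  rw [hypTime_ray hs (by linarith)]
  exact ⟨h0.trans hl, hl'.trans_lt hp.2.2⟩

lemma continuous_rayMap (p : Spacetime) : Continuous (rayMap p) := by
  refine continuous_pi fun μ => ?_
  by_cases h : μ = 4
  · subst h
    simp only [rayMap, ray, onCircle]
    simpa using continuous_snd
  · simp only [rayMap, ray_apply_of_ne h, onCircle_apply_of_ne h, hypTime_onCircle]
    fun_prop

/-- `λ d/dλ = 𝒮` along the rays. -/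
lemma hasDerivAt_ray {f : Spacetime → ℝ} {p : Spacetime} {lam : ℝ} (hl : lam ≠ 0) (y : ℝ)
    (hf : DifferentiableAt ℝ f (rayMap p (lam, y))) :
    HasDerivAt (fun l => f (rayMap p (l, y))) (lam⁻¹ * scaling f (rayMap p (lam, y))) lam := by
  set v : Spacetime := fun μ => if μ = 4 then 0 else p μ / hypTime p with hv
  have h1 : HasDerivAt (fun l => rayMap p (l, y)) v lam := by
    refine hasDerivAt_pi.mpr fun μ => ?_
    by_cases h : μ = 4
    · subst h
      simp only [rayMap, ray, if_true, hv]
      exact hasDerivAt_const _ _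
    · simp only [rayMap, ray_apply_of_ne h, onCircle_apply_of_ne h, hypTime_onCircle, hv, if_neg h]
      simpa using ((hasDerivAt_id lam).mul_const (p μ)).div_const (hypTime p)
  have h2 := hf.hasFDerivAt.comp_hasDerivAt lam h1
  refine h2.congr_deriv ?_
  have e : v = ∑ μ, v μ • (Pi.single μ 1 : Spacetime) := by
    ext ν; simp [Finset.sum_apply, Pi.single_apply]
  have e2 : ∀ μ, μ ≠ 4 → rayMap p (lam, y) μ = lam * v μ := by
    intro μ h
    simp only [rayMap, ray_apply_of_ne h, onCircle_apply_of_ne h, hypTime_onCircle, hv, if_neg h]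
    ring
  rw [e, map_sum]
  simp only [map_smul, smul_eq_mul, scaling, e2 0 (by decide), e2 _ (spat_ne_four _)]
  simp only [Fin.sum_univ_five, Fin.sum_univ_three, spat_zero, spat_one, spat_two]
  have h4 : v 4 = 0 := by simp [hv]
  rw [h4]
  simp only [pd]
  field_simp
  ring

/-- `∂_y` on the circle over a point of the ray. -/
lemma hasDerivAt_circle {f : Spacetime → ℝ} {p : Spacetime} {lam y : ℝ}
    (hf : DifferentiableAt ℝ f (rayMap p (lam, y))) :
    HasDerivAt (fun z => f (rayMap p (lam, z))) (pd 4 f (rayMap p (lam, y))) y := by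
  have h1 : HasDerivAt (fun z => rayMap p (lam, z)) (Pi.single 4 1) y := by
    refine hasDerivAt_pi.mpr fun μ => ?_
    by_cases h : μ = 4
    · subst h
      simp only [rayMap, ray, onCircle, if_true, Function.update_self, Pi.single_eq_same]
      exact hasDerivAt_id' y
    · simp only [rayMap, ray_apply_of_ne h, onCircle_apply_of_ne h, hypTime_onCircle,
        Pi.single_apply, if_neg h]
      exact hasDerivAt_const _ _
  exact hf.hasFDerivAt.comp_hasDerivAt y h1

/-! ### Regularity of averages over the circle -/

/-- The projection `(t, x, y) ↦ (t, x, 0)`. -/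
def circleProj : Spacetime →L[ℝ] Spacetime :=
  ContinuousLinearMap.id ℝ _ - (ContinuousLinearMap.proj 4).smulRight (Pi.single 4 1)

lemma onCircle_eq (p : Spacetime) (y : ℝ) :
    onCircle p y = circleProj p + y • (Pi.single 4 1 : Spacetime) := by
  ext μ
  by_cases h : μ = 4
  · subst h; simp [onCircle, circleProj]
  · simp [onCircle_apply_of_ne h, circleProj, h]

lemma continuous_onCircle : Continuous fun q : Spacetime × ℝ => onCircle q.1 q.2 := by
  simp only [onCircle_eq]; fun_prop

/-- The average over the circle is as smooth as the function is along the fibre. -/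
lemma contDiffAt_flat {f : Spacetime → ℝ} {p : Spacetime}
    (hf : ∀ y, ContDiffAt ℝ 1 f (onCircle p y)) : ContDiffAt ℝ 1 (flat f) p := by
  have hpi : (0 : ℝ) ≤ 2 * Real.pi := by positivity
  have hcf : ∀ {q : Spacetime} {y : ℝ}, ContDiffAt ℝ 1 f (onCircle q y) →
      ContinuousAt (fun z : Spacetime × ℝ => fderiv ℝ f (onCircle z.1 z.2)) (q, y) := by
    intro q y h
    have h1 : ContinuousAt (fderiv ℝ f) (onCircle (q, y).1 (q, y).2) :=
      (h.fderiv_right (m := 0) (by norm_num)).continuousAt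
    exact ContinuousAt.comp (f := fun z : Spacetime × ℝ => onCircle z.1 z.2) h1
      continuous_onCircle.continuousAt
  have hslice : ∀ {q : Spacetime} {y : ℝ}, ContDiffAt ℝ 1 f (onCircle q y) →
      ContinuousAt (fun z : ℝ => fderiv ℝ f (onCircle q z)) y := by
    intro q y h
    exact ContinuousAt.comp (f := fun z : ℝ => ((q, z) : Spacetime × ℝ)) (hcf h) (by fun_prop)
  obtain ⟨C, hC⟩ := isCompact_Icc.exists_bound_of_continuousOn (s := Icc 0 (2 * Real.pi))
    (f := fun y => fderiv ℝ f (onCircle p y)) fun y _ => (hslice (hf y)).continuousWithinAt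
  -- a tube around the fibre on which `f` is `C¹` with bounded derivative
  have htube : ∀ᶠ q in 𝓝 p, ∀ y ∈ Icc 0 (2 * Real.pi),
      ContDiffAt ℝ 1 f (onCircle q y) ∧ ‖fderiv ℝ f (onCircle q y)‖ < C + 1 := by
    refine isCompact_Icc.eventually_forall_of_forall_eventually fun y hy => ?_
    refine Filter.Eventually.and ?_ ?_
    · exact continuous_onCircle.continuousAt.eventually ((hf y).eventually (by simp))
    · exact (hcf (hf y)).norm.eventually_lt continuousAt_const
        (by have := hC y hy; simp only; linarith)
  have hmeas : ∀ {q : Spacetime}, (∀ y ∈ Icc 0 (2 * Real.pi), ContDiffAt ℝ 1 f (onCircle q y)) →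
      IntervalIntegrable (fun y => f (onCircle q y)) MeasureTheory.volume 0 (2 * Real.pi) ∧
      IntervalIntegrable (fun y => (fderiv ℝ f (onCircle q y)).comp circleProj)
        MeasureTheory.volume 0 (2 * Real.pi) := by
    intro q hq
    constructor <;> refine ContinuousOn.intervalIntegrable_of_Icc hpi fun y hy => ?_
    · have : Continuous fun z : ℝ => onCircle q z := by simp only [onCircle_eq]; fun_prop
      exact (ContinuousAt.comp (f := fun z : ℝ => onCircle q z) (hq y hy).continuousAt
        this.continuousAt).continuousWithinAt
    · exact ((hslice (hq y hy)).clm_comp continuousAt_const).continuousWithinAt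
  have hI : ∀ {y}, y ∈ uIoc 0 (2 * Real.pi) → y ∈ Icc 0 (2 * Real.pi) := fun h => by
    rw [uIoc_of_le hpi] at h; exact Ioc_subset_Icc_self h
  have hbd : ∀ {q : Spacetime} {y : ℝ}, ‖fderiv ℝ f (onCircle q y)‖ < C + 1 →
      ‖(fderiv ℝ f (onCircle q y)).comp circleProj‖ ≤ (C + 1) * ‖circleProj‖ := fun h =>
    (ContinuousLinearMap.opNorm_comp_le _ _).trans
      (mul_le_mul_of_nonneg_right h.le (norm_nonneg _))
  obtain ⟨u, hu, huo, hpu⟩ := eventually_nhds_iff.mp htube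
  refine contDiffAt_one_iff.mpr
    ⟨fun q => (2 * Real.pi)⁻¹ • ∫ y in (0 : ℝ)..(2 * Real.pi),
      (fderiv ℝ f (onCircle q y)).comp circleProj, u, huo.mem_nhds hpu, ?_, ?_⟩
  · intro q hq
    suffices hc : ContinuousAt (fun q => ∫ y in (0 : ℝ)..(2 * Real.pi),
        (fderiv ℝ f (onCircle q y)).comp circleProj) q from
      (hc.const_smul (2 * Real.pi)⁻¹).continuousWithinAt
    refine intervalIntegral.continuousAt_of_dominated_interval
      (bound := fun _ => (C + 1) * ‖circleProj‖) ?_ ?_ intervalIntegrable_const ?_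
    · filter_upwards [huo.mem_nhds hq] with z hz
      exact (intervalIntegrable_iff.mp (hmeas fun y hy => (hu z hz y hy).1).2).aestronglyMeasurable
    · filter_upwards [huo.mem_nhds hq] with z hz
      exact MeasureTheory.ae_of_all _ fun y hy => hbd (hu z hz y (hI hy)).2
    · refine MeasureTheory.ae_of_all _ fun y hy => ?_
      refine ContinuousAt.clm_comp ?_ continuousAt_const
      exact ContinuousAt.comp (f := fun z : Spacetime => ((z, y) : Spacetime × ℝ))
        (hcf (hu q hq y (hI hy)).1) (by fun_prop)
  · intro q hq
    refine HasFDerivAt.const_mul ?_ _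
    refine intervalIntegral.hasFDerivAt_integral_of_dominated_of_fderiv_le
      (F' := fun z y => (fderiv ℝ f (onCircle z y)).comp circleProj)
      (bound := fun _ => (C + 1) * ‖circleProj‖) (huo.mem_nhds hq) ?_ ?_ ?_ ?_
      intervalIntegrable_const ?_
    · filter_upwards [huo.mem_nhds hq] with z hz
      exact (intervalIntegrable_iff.mp (hmeas fun y hy => (hu z hz y hy).1).1).aestronglyMeasurable
    · exact (hmeas fun y hy => (hu q hq y hy).1).1
    · exact (intervalIntegrable_iff.mp (hmeas fun y hy => (hu q hq y hy).1).2).aestronglyMeasurable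
    · exact MeasureTheory.ae_of_all _ fun y hy z hz => hbd (hu z hz y (hI hy)).2
    · refine MeasureTheory.ae_of_all _ fun y hy z hz => ?_
      have h1 : HasFDerivAt (fun w : Spacetime => onCircle w y) circleProj z := by
        simp only [onCircle_eq]
        exact circleProj.hasFDerivAt.add_const _
      exact ((hu z hz y (hI hy)).1.differentiableAt (by simp)).hasFDerivAt.comp z h1

/-! ### The Schwarzschild tail -/

lemma contDiffAt_tail {χ : ℝ → ℝ} (hχ : IsCutoff χ) (M : ℝ) {p : Spacetime} (hp : p 0 ≠ 0) :
    ContDiffAt ℝ 1 (tail χ M) p := by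
  have hcont : Continuous radius := by unfold radius; fun_prop
  have hχ1 : ContDiff ℝ 1 χ := hχ.smooth.of_le (by exact_mod_cast le_top)
  rcases eq_or_lt_of_le (radius_nonneg p) with h0 | h0
  · -- near the axis `r = 0` the tail vanishes
    have : tail χ M =ᶠ[𝓝 p] fun _ => 0 := by
      have : ∀ᶠ q in 𝓝 p, radius q < 1 / 2 :=
        hcont.continuousAt.eventually_lt continuousAt_const (by rw [← h0]; norm_num)
      filter_upwards [this] with q hq
      simp [tail, hχ.eq_zero _ hq.le]
    exact contDiffAt_const.congr_of_eventuallyEq this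
  · have hr : ContDiffAt ℝ 1 radius p := by
      refine ContDiffAt.sqrt (ContDiffAt.sum fun a _ => (contDiffAt_coord 1 (spat a) p).pow 2) ?_
      exact (Real.sqrt_pos.mp h0).ne'
    have h1 : ContDiffAt ℝ 1 (fun q => χ (radius q / q 0)) p :=
      hχ1.contDiffAt.comp p (hr.div (contDiffAt_coord 1 0 p) hp)
    have h2 : ContDiffAt ℝ 1 (fun q => χ (radius q)) p := hχ1.contDiffAt.comp p hr
    exact (h1.mul h2).mul (contDiffAt_const.div hr h0.ne')

lemma tail_onCircle (χ : ℝ → ℝ) (M : ℝ) (p : Spacetime) (y : ℝ) :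
    tail χ M (onCircle p y) = tail χ M p := by
  simp only [tail, radius_onCircle, onCircle_zero]

/-- In the interior region the factor `χ(r)` of the tail is redundant. -/
lemma tail_of_mem {χ : ℝ → ℝ} (hχ : IsCutoff χ) (M : ℝ) {p : Spacetime}
    (hp : p ∈ interiorRegion) : tail χ M p = χ (radius p / p 0) * (M / radius p) := by
  have ht := two_le_of_mem hp
  rw [tail]
  rcases le_or_gt (radius p / p 0) (1 / 2) with h | h
  · simp [hχ.eq_zero _ h]
  · rw [lt_div_iff₀ (by linarith)] at h
    rw [hχ.eq_one (radius p) (by linarith), mul_one]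

/-- In the interior region the supports of `χ(r/t)` and `χ'(r)` do not meet. -/
lemma cutoff_mul_deriv_eq_zero {χ : ℝ → ℝ} (hχ : IsCutoff χ) {p : Spacetime}
    (hp : p ∈ interiorRegion) : χ (radius p / p 0) * deriv χ (radius p) = 0 := by
  have ht := two_le_of_mem hp
  rcases le_or_gt (radius p / p 0) (1 / 2) with h | h
  · simp [hχ.eq_zero _ h]
  · rw [lt_div_iff₀ (by linarith)] at h
    have : χ =ᶠ[𝓝 (radius p)] fun _ => 1 := by
      filter_upwards [eventually_gt_nhds (show (3 / 4 : ℝ) < radius p by linarith)] with u hu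
      exact hχ.eq_one u hu.le
    rw [this.deriv_eq]; simp

/-- On the part of a ray in the interior region `a (t² + r²) / s²` is this constant divided
by `λ`. -/
def tailConst (χ : ℝ → ℝ) (M : ℝ) (p : Spacetime) : ℝ :=
  χ (radius p / p 0) * (M * hypTime p / radius p) * ((p 0 ^ 2 + radius p ^ 2) / hypTime p ^ 2)

lemma tail_rayMap {χ : ℝ → ℝ} (hχ : IsCutoff χ) (M : ℝ) {p : Spacetime} (hs : 0 < hypTime p)
    {lam y : ℝ} (hl : 0 < lam) (h : rayMap p (lam, y) ∈ interiorRegion) :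
    tail χ M (rayMap p (lam, y)) * ((rayMap p (lam, y) 0 ^ 2 + radius (rayMap p (lam, y)) ^ 2)
      / hypTime (rayMap p (lam, y)) ^ 2) = tailConst χ M p / lam := by
  rw [tail_of_mem hχ M h, tailConst]
  simp only [rayMap, ray_onCircle, radius_onCircle, onCircle_zero, hypTime_onCircle,
    radius_ray p hl.le, ray_zero, hypTime_ray hs hl.le]
  have e1 : lam * radius p / hypTime p / (lam * p 0 / hypTime p) = radius p / p 0 := by
    rw [div_div_div_cancel_right₀ hs.ne', mul_div_mul_left _ _ hl.ne']
  have e2 : M / (lam * radius p / hypTime p) = M * hypTime p / radius p / lam := by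
    rw [div_div_eq_mul_div, div_div, mul_comm lam]
  have e3 : ((lam * p 0 / hypTime p) ^ 2 + (lam * radius p / hypTime p) ^ 2) / lam ^ 2
      = (p 0 ^ 2 + radius p ^ 2) / hypTime p ^ 2 := by field_simp
  rw [e1, e2, e3]; ring

lemma tailConst_nonneg {χ : ℝ → ℝ} (hχ : IsCutoff χ) {M : ℝ} (hM : 0 ≤ M) (p : Spacetime) :
    0 ≤ tailConst χ M p := by
  have h1 := hχ.nonneg (radius p / p 0)
  have h2 := radius_nonneg p
  have h3 : 0 ≤ hypTime p := Real.sqrt_nonneg _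
  unfold tailConst; positivity

/-- `s² ≥ 2t` in the interior region and `r > t/2` on the support of the tail. -/
lemma tail_mul_le {χ : ℝ → ℝ} (hχ : IsCutoff χ) {M K : ℝ} (hM : 0 ≤ M) (hK : ∀ u, χ u ≤ K)
    {p : Spacetime} (hp : p ∈ interiorRegion) :
    tail χ M p * ((p 0 ^ 2 + radius p ^ 2) / hypTime p ^ 2) ≤ 2 * M * K := by
  have ht := two_le_of_mem hp
  have hK0 : 0 ≤ K := (hχ.nonneg 0).trans (hK 0)
  rw [tail_of_mem hχ M hp]
  rcases le_or_gt (radius p / p 0) (1 / 2) with h | h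
  · rw [hχ.eq_zero _ h]; simp; positivity
  · have hr : p 0 / 2 < radius p := by rw [lt_div_iff₀ (by linarith)] at h; linarith
    have hlt := radius_lt_of_mem hp
    have h1 : (p 0 ^ 2 + radius p ^ 2) / hypTime p ^ 2 ≤ p 0 := by
      have h2 := two_mul_le_hypTime_sq hp
      rw [div_le_iff₀ (by linarith)]
      nlinarith [radius_nonneg p]
    have h3 : M / radius p ≤ 2 * M / p 0 := by
      rw [div_le_div_iff₀ (by linarith) (by linarith)]; nlinarith
    calc _ ≤ K * (2 * M / p 0) * p 0 := by
          have := hχ.nonneg (radius p / p 0)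
          have := hK (radius p / p 0)
          have := radius_nonneg p
          gcongr
      _ = 2 * M * K := by field_simp

lemma exists_cutoff_le {χ : ℝ → ℝ} (hχ : IsCutoff χ) : ∃ K, ∀ u, χ u ≤ K := by
  obtain ⟨K, hK⟩ := isCompact_Icc.exists_bound_of_continuousOn (s := Icc (1 / 2 : ℝ) (3 / 4))
    hχ.smooth.continuous.continuousOn
  refine ⟨max K 1, fun u => ?_⟩
  rcases le_or_gt u (1 / 2) with h | h
  · rw [hχ.eq_zero u h]; exact zero_le_one.trans (le_max_right _ _)
  rcases le_or_gt (3 / 4) u with h' | h'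
  · rw [hχ.eq_one u h']; exact le_max_right _ _
  · exact ((le_abs_self _).trans (hK u ⟨h.le, h'.le⟩)).trans (le_max_left _ _)

/-! ### The coefficients -/

lemma schwarzschildPart_onCircle (χ : ℝ → ℝ) (M : ℝ) (μ ν : Fin 5) (p : Spacetime) (y : ℝ) :
    schwarzschildPart χ M μ ν (onCircle p y) = schwarzschildPart χ M μ ν p := by
  simp only [schwarzschildPart, tail_onCircle]

lemma contDiffAt_schwarzschildPart {χ : ℝ → ℝ} (hχ : IsCutoff χ) (M : ℝ) (μ ν : Fin 5)
    {p : Spacetime} (hp : p 0 ≠ 0) : ContDiffAt ℝ 1 (schwarzschildPart χ M μ ν) p := by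
  unfold schwarzschildPart
  split_ifs
  · exact (contDiffAt_tail hχ M hp).neg
  · exact contDiffAt_const

lemma contDiffAt_flatH1 {χ : ℝ → ℝ} (hχ : IsCutoff χ) (M : ℝ) {H : TensorField} {μ ν : Fin 5}
    {p : Spacetime} (hp : p 0 ≠ 0) (hH : ∀ y, ContDiffAt ℝ 1 (H μ ν) (onCircle p y)) :
    ContDiffAt ℝ 1 (flatH1 χ M H μ ν) p :=
  contDiffAt_flat fun y => (hH y).sub
    (contDiffAt_schwarzschildPart hχ M μ ν (by rwa [onCircle_zero]))

lemma flat_eq_add_flatH1 (χ : ℝ → ℝ) (M : ℝ) {H : TensorField} {μ ν : Fin 5}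
    {p : Spacetime} (hH : ∀ y, ContDiffAt ℝ 1 (H μ ν) (onCircle p y)) :
    flat (H μ ν) p = schwarzschildPart χ M μ ν p + flatH1 χ M H μ ν p := by
  have hc : Continuous fun y => H μ ν (onCircle p y) := by
    have h1 : Continuous fun z : ℝ => onCircle p z := by simp only [onCircle_eq]; fun_prop
    exact continuous_iff_continuousAt.mpr fun y =>
      ContinuousAt.comp (f := fun z : ℝ => onCircle p z) (hH y).continuousAt h1.continuousAt
  simp only [flatH1, flat, schwarzschildPart_onCircle]
  rw [intervalIntegral.integral_sub (hc.intervalIntegrable _ _) intervalIntegrable_const,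
    intervalIntegral.integral_const]
  simp only [sub_zero, smul_eq_mul]
  field_simp
  ring

lemma cSum_onCircle (N : SphereFrame) (χ : ℝ → ℝ) (M : ℝ) (H : TensorField) (α β : Fin 5)
    (p : Spacetime) (y : ℝ) :
    cSum N (flatH1 χ M H) α β (onCircle p y) = cSum N (flatH1 χ M H) α β p := by
  have h : ∀ μ α, hypTrans μ α (onCircle p y) = hypTrans μ α p := by
    intro μ α
    unfold hypTrans
    split_ifs with h1 h2 h2
    all_goals first | rfl | rw [onCircle_zero, onCircle_apply_of_ne h2.2.2]
  simp only [cSum_eq, h, flatH1, flat_onCircle]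

lemma contDiffAt_cSum (N : SphereFrame) {T : TensorField} {p : Spacetime} (hp : p 0 ≠ 0)
    (hT : ∀ μ ν, ContDiffAt ℝ 1 (T μ ν) p) (α β : Fin 5) : ContDiffAt ℝ 1 (cSum N T α β) p := by
  have h : ∀ μ α, ContDiffAt ℝ 1 (hypTrans μ α) p := by
    intro μ α
    rw [funext (hypTrans_eq μ α)]
    split_ifs
    all_goals first
      | exact contDiffAt_const.sub (contDiffAt_hypCoef 1 μ hp)
      | exact contDiffAt_const
  rw [funext (cSum_eq N T α β)]
  exact ContDiffAt.sum fun μ _ => ContDiffAt.sum fun ν _ => (hT μ ν).mul ((h μ α).mul (h ν β))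

lemma contDiffAt_hypTime {p : Spacetime} (hs : 0 < hypTime p) : ContDiffAt ℝ 1 hypTime p := by
  have e : hypTime = fun q : Spacetime => √(q 0 ^ 2 - ∑ a : Fin 3, q (spat a) ^ 2) := by
    ext q
    rw [hypTime, radius, Real.sq_sqrt (Finset.sum_nonneg fun _ _ => sq_nonneg _)]
  have h0 : 0 < p 0 ^ 2 - ∑ a : Fin 3, p (spat a) ^ 2 := by
    rw [e] at hs; exact Real.sqrt_pos.mp hs
  rw [e]
  exact (((contDiffAt_coord 1 0 p).pow 2).sub
    (ContDiffAt.sum fun a _ => (contDiffAt_coord 1 (spat a) p).pow 2)).sqrt h0.ne'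

/-- The coefficient `π^{UV} c_{UV}^{00}` is `π` evaluated on the covector `(1, -x/t, 0)`, which
differs from `-L_♭` by `(0, (1 - r/t) x/r, 0)`, of size `1 - r/t ≤ s²/t²`. It is therefore small
together with `π_{LL}`. -/
lemma abs_cSum_zero_zero_le (N : SphereFrame) (T : TensorField) {p : Spacetime} {ε : ℝ}
    (hp : p ∈ interiorRegion) (hT : ∀ μ ν, |T μ ν p| ≤ ε)
    (hL : |lowerComp T (nullVec N 0 p) (nullVec N 0 p) p| ≤ ε * (hypTime p / p 0) ^ 2) :
    |(p 0 / hypTime p) ^ 2 * cSum N T 0 0 p| ≤ 76 * ε := by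
  have ht := two_le_of_mem hp
  have ht0 : 0 < p 0 := by linarith
  have hs := hypTime_pos_of_mem hp
  have hε : 0 ≤ ε := (abs_nonneg _).trans (hT 0 0)
  set σ := (hypTime p / p 0) ^ 2 with hσ
  have hσ0 : 0 ≤ σ := sq_nonneg _
  have hrt : radius p / p 0 ≤ 1 := by
    rw [div_le_one ht0]; exact (radius_lt_of_mem hp).le
  have hrt0 : 0 ≤ radius p / p 0 := div_nonneg (radius_nonneg p) ht0.le
  have hσe : σ = 1 - (radius p / p 0) ^ 2 := by
    rw [hσ, div_pow, hypTime_sq_of_mem hp]; field_simp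
  -- `l` is `L_♭`, and `w` is the error in `(1, -x/t, 0) = -L_♭ + w`
  set l := lowerIdx (nullVec N 0 p) with hl
  set w : Fin 5 → ℝ := fun μ => hypTrans μ 0 p + l μ with hw
  have hω : ∀ a, |N.e 0 (fun a => p (spat a)) a| ≤ 1 := by
    intro a
    have h := N.orthonormal (fun a => p (spat a)) 0 0
    rw [if_pos rfl] at h
    rw [← sq_le_one_iff_abs_le_one, sq, ← h]
    exact Finset.single_le_sum (f := fun a => N.e 0 (fun a => p (spat a)) a
      * N.e 0 (fun a => p (spat a)) a) (fun _ _ => mul_self_nonneg _) (Finset.mem_univ a)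
  have hlval : l 0 = -1 ∧ (∀ a, l (spat a) = N.e 0 (fun a => p (spat a)) a) ∧ l 4 = 0 := by
    refine ⟨by simp [hl, lowerIdx, nullVec], fun a => ?_, by simp [hl, lowerIdx, nullVec]⟩
    fin_cases a <;> simp [hl, lowerIdx, nullVec, spat]
  have hcases : ∀ P : Fin 5 → Prop, P 0 → (∀ a, P (spat a)) → P 4 → ∀ μ, P μ := by
    intro P h0 ha h4 μ
    fin_cases μ
    exacts [h0, ha 0, ha 1, ha 2, h4]
  have hl1 : ∀ μ, |l μ| ≤ 1 := by
    refine hcases _ ?_ (fun a => ?_) ?_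
    · rw [hlval.1]; simp
    · rw [hlval.2.1]; exact hω a
    · rw [hlval.2.2]; simp
  have hwσ : ∀ μ, |w μ| ≤ σ := by
    refine hcases _ ?_ (fun a => ?_) ?_
    · simpa [hw, hlval.1, hypTrans] using hσ0
    · have h1 : spat a ≠ 0 := by fin_cases a <;> decide
      have h2 := N.radial (fun a => p (spat a)) a
      change p (spat a) = radius p * _ at h2
      have h3 : w (spat a) = (1 - radius p / p 0) * N.e 0 (fun a => p (spat a)) a := by
        simp only [hw, hlval.2.1, hypTrans, h1, spat_ne_four, if_false, ne_eq, not_false_eq_true,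
          and_self, if_true]
        rw [h2]; ring
      rw [h3, abs_mul, abs_of_nonneg (by linarith)]
      have := hω a
      have := abs_nonneg (N.e 0 (fun a => p (spat a)) a)
      nlinarith
    · simpa [hw, hlval.2.2, hypTrans] using hσ0
  have hσ1 : σ ≤ 1 := by rw [hσe]; nlinarith
  have e : cSum N T 0 0 p = lowerComp T (nullVec N 0 p) (nullVec N 0 p) p
      + ∑ μ, ∑ ν, T μ ν p * (w μ * w ν - l μ * w ν - w μ * l ν) := by
    rw [cSum_eq, lowerComp, ← Finset.sum_add_distrib]
    refine Finset.sum_congr rfl fun μ _ => ?_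
    rw [← Finset.sum_add_distrib]
    refine Finset.sum_congr rfl fun ν _ => ?_
    simp only [hw, ← hl]; ring
  have hterm : ∀ μ ν, |T μ ν p * (w μ * w ν - l μ * w ν - w μ * l ν)| ≤ ε * (3 * σ) := by
    intro μ ν
    rw [abs_mul]
    refine mul_le_mul (hT μ ν) ?_ (abs_nonneg _) hε
    have h1 : |w μ * w ν| ≤ 1 * σ := by
      rw [abs_mul]; exact mul_le_mul ((hwσ μ).trans hσ1) (hwσ ν) (abs_nonneg _) zero_le_one
    have h2 : |l μ * w ν| ≤ 1 * σ := by
      rw [abs_mul]; exact mul_le_mul (hl1 μ) (hwσ ν) (abs_nonneg _) zero_le_one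
    have h3 : |w μ * l ν| ≤ σ * 1 := by
      rw [abs_mul]; exact mul_le_mul (hwσ μ) (hl1 ν) (abs_nonneg _) hσ0
    rw [abs_le] at *
    constructor <;> linarith [h1.1, h1.2, h2.1, h2.2, h3.1, h3.2]
  have hsum : |∑ μ, ∑ ν, T μ ν p * (w μ * w ν - l μ * w ν - w μ * l ν)| ≤ 75 * ε * σ := by
    calc _ ≤ ∑ _μ : Fin 5, ∑ _ν : Fin 5, ε * (3 * σ) :=
          (Finset.abs_sum_le_sum_abs _ _).trans (Finset.sum_le_sum fun μ _ =>
            (Finset.abs_sum_le_sum_abs _ _).trans (Finset.sum_le_sum fun ν _ => hterm μ ν))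
      _ = 75 * ε * σ := by simp; ring
  have hσinv : (p 0 / hypTime p) ^ 2 * σ = 1 := by rw [hσ]; field_simp
  rw [abs_mul, abs_of_nonneg (sq_nonneg (p 0 / hypTime p)), e]
  calc (p 0 / hypTime p) ^ 2 * |_ + _| ≤ (p 0 / hypTime p) ^ 2 * (ε * σ + 75 * ε * σ) :=
        mul_le_mul_of_nonneg_left ((abs_add_le _ _).trans (add_le_add hL hsum)) (sq_nonneg _)
    _ = 76 * ε * ((p 0 / hypTime p) ^ 2 * σ) := by ring
    _ = 76 * ε := by rw [hσinv, mul_one]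

lemma scaling_onCircle {f : Spacetime → ℝ} (hf : ∀ q y, f (onCircle q y) = f q) (p : Spacetime)
    (y : ℝ) : scaling f (onCircle p y) = scaling f p := by
  have h : ∀ μ, pd μ f (onCircle p y) = pd μ f p := by
    intro μ
    have e : f = fun q => f (q + (y - p 4) • (Pi.single 4 1 : Spacetime)) := by
      ext q
      rw [← hf q (q 4 + (y - p 4))]
      congr 1
      ext ν
      by_cases h : ν = 4
      · subst h; simp [onCircle]
      · simp [onCircle_apply_of_ne h, h]
    have e2 : onCircle p y = p + (y - p 4) • (Pi.single 4 1 : Spacetime) := by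
      ext ν
      by_cases h : ν = 4
      · subst h; simp [onCircle]
      · simp [onCircle_apply_of_ne h, h]
    conv_rhs => rw [e]
    rw [pd, pd, fderiv_comp_add_right, e2]
  simp only [scaling, h, onCircle_zero, onCircle_apply_of_ne (spat_ne_four _)]

/-! ### Integrals over the circle depending on a parameter -/

lemma continuousOn_circleIntegral {G : ℝ × ℝ → ℝ} {J : Set ℝ} (hG : ContinuousOn G (J ×ˢ univ))
    (c d : ℝ) : ContinuousOn (fun l => ∫ y in c..d, G (l, y)) J := by
  rw [continuousOn_iff_continuous_domRestrict]
  refine intervalIntegral.continuous_parametric_intervalIntegral_of_continuous'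
    (f := fun (l : J) y => G (l, y)) ?_ c d
  exact hG.comp_continuous (by fun_prop) fun q => ⟨q.1.2, mem_univ _⟩

lemma continuous_slice {G : ℝ × ℝ → ℝ} {J : Set ℝ} (hG : ContinuousOn G (J ×ˢ univ)) {l : ℝ}
    (hl : l ∈ J) : Continuous fun y => G (l, y) :=
  hG.comp_continuous (by fun_prop) fun _ => ⟨hl, mem_univ _⟩

lemma hasDerivAt_circleIntegral {G G' : ℝ × ℝ → ℝ} {a b c d : ℝ} (hcd : c ≤ d)
    (hG : ContinuousOn G (Icc a b ×ˢ univ)) (hG' : ContinuousOn G' (Icc a b ×ˢ univ))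
    (hd : ∀ l ∈ Icc a b, ∀ y, HasDerivAt (fun k => G (k, y)) (G' (l, y)) l)
    {l : ℝ} (hl : l ∈ Ioo a b) :
    HasDerivAt (fun k => ∫ y in c..d, G (k, y)) (∫ y in c..d, G' (l, y)) l := by
  obtain ⟨C, hC⟩ := (isCompact_Icc.prod isCompact_Icc).exists_bound_of_continuousOn
    (hG'.mono (prod_mono_right (subset_univ (Icc c d))))
  have hmem : Ioo a b ∈ 𝓝 l := Ioo_mem_nhds hl.1 hl.2
  refine (intervalIntegral.hasDerivAt_integral_of_dominated_loc_of_deriv_le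
    (F := fun k y => G (k, y)) (F' := fun k y => G' (k, y)) (bound := fun _ => C) hmem
    ?_ ?_ ?_ ?_ intervalIntegrable_const ?_).2
  · filter_upwards [hmem] with k hk
    exact (continuous_slice hG (Ioo_subset_Icc_self hk)).aestronglyMeasurable
  · exact (continuous_slice hG (Ioo_subset_Icc_self hl)).intervalIntegrable _ _
  · exact (continuous_slice hG' (Ioo_subset_Icc_self hl)).aestronglyMeasurable
  · refine MeasureTheory.ae_of_all _ fun y hy k hk => hC (k, y) ⟨Ioo_subset_Icc_self hk, ?_⟩
    rw [uIoc_of_le hcd] at hy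
    exact Ioc_subset_Icc_self hy
  · exact MeasureTheory.ae_of_all _ fun y _ k hk => hd k (Ioo_subset_Icc_self hk) y

lemma abs_integral_mul_le {f g : ℝ → ℝ} (hf : Continuous f) (hg : Continuous g) {c d : ℝ}
    (hcd : c ≤ d) :
    |∫ y in c..d, f y * g y| ≤ √(∫ y in c..d, f y ^ 2) * √(∫ y in c..d, g y ^ 2) := by
  set V := ∫ y in c..d, f y ^ 2
  set R := ∫ y in c..d, g y ^ 2
  set I := ∫ y in c..d, f y * g y
  have hV : 0 ≤ V := intervalIntegral.integral_nonneg hcd fun _ _ => sq_nonneg _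
  have hquad : ∀ t : ℝ, 0 ≤ R * (t * t) + (-2 * I) * t + V := by
    intro t
    have h1 : 0 ≤ ∫ y in c..d, (t * g y - f y) ^ 2 :=
      intervalIntegral.integral_nonneg hcd fun _ _ => sq_nonneg _
    have h2 : ∫ y in c..d, (t * g y - f y) ^ 2 = t ^ 2 * R - (2 * t) * I + V := by
      rw [← intervalIntegral.integral_const_mul, ← intervalIntegral.integral_const_mul,
        ← intervalIntegral.integral_sub, ← intervalIntegral.integral_add]
      · congr 1; ext y; ring
      all_goals apply Continuous.intervalIntegrable; fun_prop
    rw [h2] at h1; linarith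
  have hdisc := discrim_le_zero hquad
  rw [discrim] at hdisc
  rw [← Real.sqrt_mul hV]
  exact Real.abs_le_sqrt (by nlinarith)

/-- A mean-free function on the circle has a zero, so it is bounded by the integral of its
derivative. -/
lemma sqrt_integral_sq_le_deriv {f f' : ℝ → ℝ} (hf : ∀ y, HasDerivAt f (f' y) y)
    (hf' : Continuous f') {d : ℝ} (hd : 0 < d) (h0 : ∫ y in (0 : ℝ)..d, f y = 0) :
    √(∫ y in (0 : ℝ)..d, f y ^ 2) ≤ d * √(∫ y in (0 : ℝ)..d, f' y ^ 2) := by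
  have hc : Continuous f := continuous_iff_continuousAt.mpr fun y => (hf y).continuousAt
  obtain ⟨y₀, hy₀, hz⟩ : ∃ y₀ ∈ Icc 0 d, f y₀ = 0 := by
    obtain ⟨y₀, hy₀, h⟩ := exists_eq_interval_average hd.ne hc.continuousOn
    refine ⟨y₀, ?_, ?_⟩
    · rw [uIoo_of_le hd.le] at hy₀; exact Ioo_subset_Icc_self hy₀
    · rw [h, interval_average_eq, h0, smul_zero]
  have hW : 0 ≤ ∫ y in (0 : ℝ)..d, f' y ^ 2 :=
    intervalIntegral.integral_nonneg hd.le fun _ _ => sq_nonneg _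
  have hL1 : ∫ y in (0 : ℝ)..d, |f' y| ≤ √d * √(∫ y in (0 : ℝ)..d, f' y ^ 2) := by
    have := abs_integral_mul_le (continuous_const (y := (1 : ℝ))) hf'.abs hd.le
    simp only [one_mul, one_pow, sq_abs, intervalIntegral.integral_const, smul_eq_mul, mul_one,
      sub_zero] at this
    exact (le_abs_self _).trans this
  have hpt : ∀ y ∈ Icc 0 d, f y ^ 2 ≤ d * ∫ y in (0 : ℝ)..d, f' y ^ 2 := by
    intro y hy
    have h1 : f y = ∫ u in y₀..y, f' u := by
      rw [intervalIntegral.integral_eq_sub_of_hasDerivAt (fun u _ => hf u)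
        (hf'.intervalIntegrable _ _), hz, sub_zero]
    have h2 : |f y| ≤ ∫ y in (0 : ℝ)..d, |f' y| := by
      rw [h1]
      refine (intervalIntegral.norm_integral_le_abs_integral_norm (f := f')).trans ?_
      simp only [Real.norm_eq_abs]
      refine (intervalIntegral.abs_integral_mono_interval (c := 0) (d := d) ?_ ?_
        (hf'.abs.intervalIntegrable _ _)).trans (le_of_eq ?_)
      · rw [uIoc_of_le hd.le]
        intro u hu
        rw [uIoc, mem_Ioc] at hu
        exact ⟨(le_inf hy₀.1 hy.1).trans_lt hu.1, hu.2.trans (sup_le hy₀.2 hy.2)⟩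
      · exact MeasureTheory.ae_of_all _ fun _ => abs_nonneg _
      · exact abs_of_nonneg (intervalIntegral.integral_nonneg hd.le fun _ _ => abs_nonneg _)
    calc f y ^ 2 = |f y| ^ 2 := (sq_abs _).symm
      _ ≤ (√d * √(∫ y in (0 : ℝ)..d, f' y ^ 2)) ^ 2 := by
          gcongr; exact h2.trans hL1
      _ = _ := by rw [mul_pow, Real.sq_sqrt hd.le, Real.sq_sqrt hW]
  refine Real.sqrt_le_iff.mpr ⟨by positivity, ?_⟩
  rw [mul_pow, Real.sq_sqrt hW]
  calc ∫ y in (0 : ℝ)..d, f y ^ 2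
      ≤ ∫ _y in (0 : ℝ)..d, d * ∫ y in (0 : ℝ)..d, f' y ^ 2 :=
        intervalIntegral.integral_mono_on hd.le ((hc.pow 2).intervalIntegrable _ _)
          intervalIntegrable_const hpt
    _ = _ := by simp; ring

/-! ### The energy inequality -/

/-- Grönwall's inequality for `E' ≤ 2AE + 2cB√E`. -/
lemma sqrt_le_of_deriv_le {E E' A B : ℝ → ℝ} {a b c : ℝ} (hab : a ≤ b) (hc : 0 ≤ c)
    (hE : ContinuousOn E (Icc a b)) (hA : ContinuousOn A (Icc a b))
    (hB : ContinuousOn B (Icc a b)) (hE0 : ∀ l ∈ Icc a b, 0 ≤ E l)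
    (hA0 : ∀ l ∈ Icc a b, 0 ≤ A l) (hB0 : ∀ l ∈ Icc a b, 0 ≤ B l)
    (hd : ∀ l ∈ Ioo a b, HasDerivAt E (E' l) l)
    (hle : ∀ l ∈ Ioo a b, E' l ≤ 2 * A l * E l + 2 * c * B l * √(E l)) :
    √(E b) ≤ (√(E a) + c * ∫ l in a..b, B l) * Real.exp (∫ l in a..b, A l) := by
  have hprim : ∀ {f : ℝ → ℝ}, ContinuousOn f (Icc a b) →
      ContinuousOn (fun x => ∫ l in a..x, f l) (Icc a b) ∧
      ∀ x ∈ Ioo a b, HasDerivAt (fun x => ∫ l in a..x, f l) (f x) x := by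
    intro f hf
    have hint : IntervalIntegrable f MeasureTheory.volume a b :=
      hf.intervalIntegrable_of_Icc hab
    refine ⟨?_, fun x hx => ?_⟩
    · have := intervalIntegral.continuousOn_primitive_interval
        (f := f) (a := a) (b := b) (μ := MeasureTheory.volume)
        (by rw [uIcc_of_le hab]; exact hf.integrableOn_Icc)
      rwa [uIcc_of_le hab] at this
    · refine intervalIntegral.integral_hasDerivAt_right
        (hint.mono_set ?_) ?_ (hf.continuousAt (Icc_mem_nhds hx.1 hx.2))
      · rw [uIcc_of_le hab, uIcc_of_le hx.1.le]; exact Icc_subset_Icc_right hx.2.le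
      · exact (hf.mono Ioo_subset_Icc_self).stronglyMeasurableAtFilter isOpen_Ioo x hx
  obtain ⟨hAc, hAd⟩ := hprim hA
  obtain ⟨hBc, hBd⟩ := hprim hB
  have hKnn : ∀ l ∈ Icc a b, 0 ≤ ∫ k in a..l, A k := fun l hl =>
    intervalIntegral.integral_nonneg hl.1 fun k hk => hA0 k ⟨hk.1, hk.2.trans hl.2⟩
  -- the square root is regularised because `E` may vanish
  have key : ∀ δ : ℝ, 0 < δ → √(E b) ≤ (√(E a) + c * ∫ l in a..b, B l)
      * Real.exp (∫ l in a..b, A l) + δ * Real.exp (∫ l in a..b, A l) := by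
    intro δ hδ
    set g : ℝ → ℝ := fun l => √(E l + δ ^ 2) with hg
    set G : ℝ → ℝ := fun l => Real.exp (-∫ k in a..l, A k) * g l - c * ∫ k in a..l, B k with hG
    have hpos : ∀ l ∈ Icc a b, 0 < E l + δ ^ 2 := fun l hl => by
      have := hE0 l hl; positivity
    have hanti : AntitoneOn G (Icc a b) := by
      refine antitoneOn_of_hasDerivWithinAt_nonpos (convex_Icc a b)
        (f' := fun l => (Real.exp (-∫ k in a..l, A k) * (-A l)) * g l
          + Real.exp (-∫ k in a..l, A k) * (E' l / (2 * g l)) - c * B l) ?_ ?_ ?_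
      · exact (hAc.neg.rexp.mul (hE.add continuousOn_const).sqrt).sub
          (continuousOn_const.mul hBc)
      · intro l hl
        rw [interior_Icc] at hl
        have h1 : HasDerivAt g (E' l / (2 * g l)) l :=
          ((hd l hl).add_const _).sqrt (hpos l (Ioo_subset_Icc_self hl)).ne'
        exact (((hAd l hl).neg.exp.mul h1).sub ((hBd l hl).const_mul c)).hasDerivWithinAt
      · intro l hl
        rw [interior_Icc] at hl
        have hl' := Ioo_subset_Icc_self hl
        have hg0 : 0 < g l := Real.sqrt_pos.mpr (hpos l hl')
        have hgE : g l ^ 2 = E l + δ ^ 2 := Real.sq_sqrt (hpos l hl').le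
        have hsE : √(E l) ≤ g l := Real.sqrt_le_sqrt (by nlinarith)
        have hA0' := hA0 l hl'
        have hB0' := hB0 l hl'
        have h1 : E' l / (2 * g l) ≤ A l * g l + c * B l := by
          rw [div_le_iff₀ (by positivity)]
          have h2 : 2 * A l * E l ≤ 2 * A l * g l ^ 2 :=
            mul_le_mul_of_nonneg_left (by nlinarith) (by positivity)
          have h3 : 2 * c * B l * √(E l) ≤ 2 * c * B l * g l :=
            mul_le_mul_of_nonneg_left hsE (by positivity)
          have := hle l hl
          nlinarith
        have he0 := Real.exp_pos (-∫ k in a..l, A k)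
        have he1 : Real.exp (-∫ k in a..l, A k) ≤ 1 :=
          Real.exp_le_one_iff.mpr (by linarith [hKnn l hl'])
        have h4 := mul_le_mul_of_nonneg_left h1 he0.le
        have h5 := mul_le_mul_of_nonneg_right he1 (mul_nonneg hc hB0')
        nlinarith
    have h := hanti (left_mem_Icc.mpr hab) (right_mem_Icc.mpr hab) hab
    simp only [hG, intervalIntegral.integral_same, neg_zero, Real.exp_zero, one_mul, mul_zero,
      sub_zero] at h
    have h1 : g a ≤ √(E a) + δ := by
      refine Real.sqrt_le_iff.mpr ⟨by positivity, ?_⟩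
      have := Real.sq_sqrt (hE0 a (left_mem_Icc.mpr hab))
      nlinarith [Real.sqrt_nonneg (E a)]
    have h2 : √(E b) ≤ g b := Real.sqrt_le_sqrt (by nlinarith)
    have h3 := Real.exp_pos (∫ l in a..b, A l)
    have h4 : Real.exp (-∫ k in a..b, A k) * g b ≤ √(E a) + δ + c * ∫ k in a..b, B k := by
      linarith
    have h5 := mul_le_mul_of_nonneg_left h4 h3.le
    rw [← mul_assoc, ← Real.exp_add, add_neg_cancel, Real.exp_zero, one_mul] at h5
    linarith
  refine le_of_forall_pos_le_add fun η hη => ?_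
  have h3 := Real.exp_pos (∫ l in a..b, A l)
  have := key (η / Real.exp (∫ l in a..b, A l)) (by positivity)
  rwa [div_mul_cancel₀ _ h3.ne'] at this

/-- The energy inequality for the first order system `α v_λ = β z_y + κ v_y + ρ`, `z_λ = v_y` on the
circle, whose coefficients depend on `λ` only. -/
lemma energy_inequality {v vl vy z zy ρ : ℝ × ℝ → ℝ} {α α' β β' κ A : ℝ → ℝ} {a b d : ℝ}
    (hab : a ≤ b) (hd : 0 ≤ d)
    (hv : ContinuousOn v (Icc a b ×ˢ univ)) (hvl : ContinuousOn vl (Icc a b ×ˢ univ))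
    (hvy : ContinuousOn vy (Icc a b ×ˢ univ)) (hz : ContinuousOn z (Icc a b ×ˢ univ))
    (hzy : ContinuousOn zy (Icc a b ×ˢ univ)) (hρ : ContinuousOn ρ (Icc a b ×ˢ univ))
    (hA : ContinuousOn A (Icc a b)) (hA0 : ∀ l ∈ Icc a b, 0 ≤ A l)
    (hα : ∀ l ∈ Icc a b, HasDerivAt α (α' l) l) (hβ : ∀ l ∈ Icc a b, HasDerivAt β (β' l) l)
    (hα1 : ∀ l ∈ Icc a b, 3 / 4 ≤ α l) (hβ1 : ∀ l ∈ Icc a b, 3 / 4 ≤ β l)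
    (hαA : ∀ l ∈ Icc a b, α' l ≤ A l) (hβA : ∀ l ∈ Icc a b, β' l ≤ A l)
    (hdvl : ∀ l ∈ Icc a b, ∀ y, HasDerivAt (fun k => v (k, y)) (vl (l, y)) l)
    (hdzl : ∀ l ∈ Icc a b, ∀ y, HasDerivAt (fun k => z (k, y)) (vy (l, y)) l)
    (hdvy : ∀ l ∈ Icc a b, ∀ y, HasDerivAt (fun k => v (l, k)) (vy (l, y)) y)
    (hdzy : ∀ l ∈ Icc a b, ∀ y, HasDerivAt (fun k => z (l, k)) (zy (l, y)) y)
    (hvper : ∀ l ∈ Icc a b, v (l, d) = v (l, 0)) (hzper : ∀ l ∈ Icc a b, z (l, d) = z (l, 0))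
    (heq : ∀ l ∈ Icc a b, ∀ y,
      α l * vl (l, y) = β l * zy (l, y) + κ l * vy (l, y) + ρ (l, y)) :
    √(α b * (∫ y in (0 : ℝ)..d, v (b, y) ^ 2) + β b * ∫ y in (0 : ℝ)..d, z (b, y) ^ 2)
      ≤ (√(α a * (∫ y in (0 : ℝ)..d, v (a, y) ^ 2) + β a * ∫ y in (0 : ℝ)..d, z (a, y) ^ 2)
        + 2 * ∫ l in a..b, √(∫ y in (0 : ℝ)..d, ρ (l, y) ^ 2))
        * Real.exp (∫ l in a..b, A l) := by
  have hV0 : ∀ l, 0 ≤ ∫ y in (0 : ℝ)..d, v (l, y) ^ 2 := fun l =>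
    intervalIntegral.integral_nonneg hd fun _ _ => sq_nonneg _
  have hZ0 : ∀ l, 0 ≤ ∫ y in (0 : ℝ)..d, z (l, y) ^ 2 := fun l =>
    intervalIntegral.integral_nonneg hd fun _ _ => sq_nonneg _
  have hαc : ContinuousOn α (Icc a b) := fun l hl => (hα l hl).continuousAt.continuousWithinAt
  have hβc : ContinuousOn β (Icc a b) := fun l hl => (hβ l hl).continuousAt.continuousWithinAt
  have hVc := continuousOn_circleIntegral (hv.pow 2) 0 d
  have hZc := continuousOn_circleIntegral (hz.pow 2) 0 d
  refine sqrt_le_of_deriv_le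
    (E := fun l => α l * (∫ y in (0 : ℝ)..d, v (l, y) ^ 2) + β l * ∫ y in (0 : ℝ)..d, z (l, y) ^ 2)
    (E' := fun l => α' l * (∫ y in (0 : ℝ)..d, v (l, y) ^ 2)
      + β' l * (∫ y in (0 : ℝ)..d, z (l, y) ^ 2) + 2 * ∫ y in (0 : ℝ)..d, v (l, y) * ρ (l, y))
    hab zero_le_two ((hαc.mul hVc).add (hβc.mul hZc)) hA
    (continuousOn_circleIntegral (hρ.pow 2) 0 d).sqrt ?_ hA0 (fun _ _ => Real.sqrt_nonneg _) ?_ ?_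
  · intro l hl
    have := hα1 l hl
    have := hβ1 l hl
    have := hV0 l
    have := hZ0 l
    positivity
  · intro l hl
    have hl' := Ioo_subset_Icc_self hl
    have h1 : HasDerivAt (fun l => ∫ y in (0 : ℝ)..d, v (l, y) ^ 2)
        (∫ y in (0 : ℝ)..d, 2 * v (l, y) * vl (l, y)) l :=
      hasDerivAt_circleIntegral (G := fun q => v q ^ 2) (G' := fun q => 2 * v q * vl q) hd
        (hv.pow 2) ((continuousOn_const.mul hv).mul hvl)
        (fun k hk y => by simpa using (hdvl k hk y).fun_pow 2) hl
    have h2 : HasDerivAt (fun l => ∫ y in (0 : ℝ)..d, z (l, y) ^ 2)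
        (∫ y in (0 : ℝ)..d, 2 * z (l, y) * vy (l, y)) l :=
      hasDerivAt_circleIntegral (G := fun q => z q ^ 2) (G' := fun q => 2 * z q * vy q) hd
        (hz.pow 2) ((continuousOn_const.mul hz).mul hvy)
        (fun k hk y => by simpa using (hdzl k hk y).fun_pow 2) hl
    refine (((hα l hl').mul h1).add ((hβ l hl').mul h2)).congr_deriv ?_
    have cv := continuous_slice hv hl'
    have cvl := continuous_slice hvl hl'
    have cvy := continuous_slice hvy hl'
    have cz := continuous_slice hz hl'
    have czy := continuous_slice hzy hl'
    have cρ := continuous_slice hρ hl'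
    have cflux : Continuous fun y => 2 * β l * (vy (l, y) * z (l, y) + v (l, y) * zy (l, y))
        + κ l * (2 * v (l, y) * vy (l, y)) :=
      (continuous_const.mul ((cvy.mul cz).add (cv.mul czy))).add
        (continuous_const.mul ((continuous_const.mul cv).mul cvy))
    -- the fluxes `2 β v z + κ v²` integrate to zero over the circle
    have hflux : ∫ y in (0 : ℝ)..d, (2 * β l * (vy (l, y) * z (l, y) + v (l, y) * zy (l, y))
        + κ l * (2 * v (l, y) * vy (l, y))) = 0 := by
      rw [intervalIntegral.integral_eq_sub_of_hasDerivAt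
        (f := fun y => 2 * β l * (v (l, y) * z (l, y)) + κ l * v (l, y) ^ 2)]
      · simp only [hvper l hl', hzper l hl', sub_self]
      · intro y _
        exact (((hdvy l hl' y).fun_mul (hdzy l hl' y)).const_mul _).fun_add
          (((hdvy l hl' y).fun_pow 2).const_mul _ |>.congr_deriv (by simp))
      · exact cflux.intervalIntegrable _ _
    have hsum : α l * (∫ y in (0 : ℝ)..d, 2 * v (l, y) * vl (l, y))
        + β l * (∫ y in (0 : ℝ)..d, 2 * z (l, y) * vy (l, y))
        = (∫ y in (0 : ℝ)..d, (2 * β l * (vy (l, y) * z (l, y) + v (l, y) * zy (l, y))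
          + κ l * (2 * v (l, y) * vy (l, y)))) + 2 * ∫ y in (0 : ℝ)..d, v (l, y) * ρ (l, y) := by
      simp only [← intervalIntegral.integral_const_mul]
      rw [← intervalIntegral.integral_add, ← intervalIntegral.integral_add]
      · congr 1; ext y
        linear_combination 2 * v (l, y) * heq l hl' y
      · exact cflux.intervalIntegrable _ _
      · exact (continuous_const.mul (cv.mul cρ)).intervalIntegrable _ _
      · exact (continuous_const.mul ((continuous_const.mul cv).mul cvl)).intervalIntegrable _ _
      · exact (continuous_const.mul ((continuous_const.mul cz).mul cvy)).intervalIntegrable _ _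
    rw [hflux] at hsum
    linarith
  · intro l hl
    have hl' := Ioo_subset_Icc_self hl
    have hV := hV0 l
    have hZ := hZ0 l
    have hα2 := hα1 l hl'
    have hβ2 := hβ1 l hl'
    have hcs := (abs_le.mp (abs_integral_mul_le (continuous_slice hv hl')
      (continuous_slice hρ hl') hd)).2
    set V := ∫ y in (0 : ℝ)..d, v (l, y) ^ 2
    set Z := ∫ y in (0 : ℝ)..d, z (l, y) ^ 2
    set R := √(∫ y in (0 : ℝ)..d, ρ (l, y) ^ 2)
    have hR : 0 ≤ R := Real.sqrt_nonneg _
    have h1 : √V ≤ 2 * √(α l * V + β l * Z) := by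
      rw [show (2 : ℝ) = √(2 ^ 2) by rw [Real.sqrt_sq zero_le_two],
        ← Real.sqrt_mul (by norm_num)]
      refine Real.sqrt_le_sqrt ?_
      nlinarith [mul_le_mul_of_nonneg_right hα2 hV, mul_le_mul_of_nonneg_right hβ2 hZ]
    have h2 : α' l * V ≤ A l * V := mul_le_mul_of_nonneg_right (hαA l hl') hV
    have h3 : β' l * Z ≤ A l * Z := mul_le_mul_of_nonneg_right (hβA l hl') hZ
    have h4 : A l * (V + Z) ≤ A l * (2 * (α l * V + β l * Z)) :=
      mul_le_mul_of_nonneg_left (by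
        nlinarith [mul_le_mul_of_nonneg_right hα2 hV, mul_le_mul_of_nonneg_right hβ2 hZ])
        (hA0 l hl')
    have h5 := mul_le_mul_of_nonneg_right h1 hR
    nlinarith

/-! ### The energy along a ray -/

lemma IsCirclePeriodic.add_single {f : Spacetime → ℝ} (hf : IsCirclePeriodic f) (q : Spacetime) :
    f (q + (2 * Real.pi) • (Pi.single 4 1 : Spacetime)) = f q := by
  have h : ∀ y, onCircle q (q 4 + y) = q + y • (Pi.single 4 1 : Spacetime) := by
    intro y
    ext ν
    by_cases h : ν = 4
    · subst h; simp [onCircle]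
    · simp [onCircle_apply_of_ne h, h]
  have h0 := h 0
  simp only [add_zero, zero_smul] at h0
  rw [← h, hf q (q 4), h0]

lemma IsCirclePeriodic.pd {f : Spacetime → ℝ} (hf : IsCirclePeriodic f) (μ : Fin 5) :
    IsCirclePeriodic (pd μ f) := by
  intro p y
  have e : f = fun q => f (q + (2 * Real.pi) • (Pi.single 4 1 : Spacetime)) :=
    funext fun q => (hf.add_single q).symm
  have e2 : onCircle p (y + 2 * Real.pi)
      = onCircle p y + (2 * Real.pi) • (Pi.single 4 1 : Spacetime) := by
    rw [onCircle_eq, onCircle_eq, add_smul, add_assoc]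
  conv_rhs => rw [e]
  rw [KaluzaKlein.pd, KaluzaKlein.pd, fderiv_comp_add_right, e2]

lemma IsCirclePeriodic.scaling {f : Spacetime → ℝ} (hf : IsCirclePeriodic f) :
    IsCirclePeriodic (scaling f) := by
  intro p y
  have h := fun μ => hf.pd μ p y
  simp only [KaluzaKlein.scaling, h, onCircle_zero, onCircle_apply_of_ne (spat_ne_four _)]

/-- The coefficient `(t/s)² (H^{1,UV})^♭ c_{UV}^{00}`. -/
def timeCoef (χ : ℝ → ℝ) (M : ℝ) (N : SphereFrame) (H : TensorField) (q : Spacetime) : ℝ :=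
  (q 0 / hypTime q) ^ 2 * cSum N (flatH1 χ M H) 0 0 q

lemma timeCoef_onCircle (χ : ℝ → ℝ) (M : ℝ) (N : SphereFrame) (H : TensorField) (q : Spacetime)
    (y : ℝ) : timeCoef χ M N H (onCircle q y) = timeCoef χ M N H q := by
  simp only [timeCoef, onCircle_zero, hypTime_onCircle, cSum_onCircle]

lemma rayMap_eq (p : Spacetime) (lam y : ℝ) : rayMap p (lam, y) = onCircle (ray p lam) y :=
  ray_onCircle p y lam

lemma eq_rayMap_zero {f : Spacetime → ℝ} (hf : ∀ q y, f (onCircle q y) = f q) (p : Spacetime)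
    (lam y : ℝ) : f (rayMap p (lam, y)) = f (rayMap p (lam, 0)) := by
  rw [rayMap_eq, rayMap_eq, hf, hf]

/-- The suprema in `A` are over constants, and the last one vanishes in the interior region. -/
lemma A_eq {χ : ℝ → ℝ} (hχ : IsCutoff χ) (M : ℝ) (N : SphereFrame) (H : TensorField)
    {p : Spacetime} {lam : ℝ} (h : ∀ y, rayMap p (lam, y) ∈ interiorRegion) :
    A χ M N H p lam = |lam⁻¹ * scaling (timeCoef χ M N H) (rayMap p (lam, 0))|
      + |lam⁻¹ * scaling (flatH1 χ M H 4 4) (rayMap p (lam, 0))| := by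
  have h1 : ∀ y, |lam⁻¹ * scaling (fun q => (q 0 / hypTime q) ^ 2 * cSum N (flatH1 χ M H) 0 0 q)
      (ray (onCircle p y) lam)|
      = |lam⁻¹ * scaling (timeCoef χ M N H) (rayMap p (lam, 0))| := by
    intro y
    rw [← eq_rayMap_zero (scaling_onCircle (timeCoef_onCircle χ M N H)) p lam y]
    rfl
  have h2 : ∀ y, |lam⁻¹ * scaling (flatH1 χ M H 4 4) (ray (onCircle p y) lam)|
      = |lam⁻¹ * scaling (flatH1 χ M H 4 4) (rayMap p (lam, 0))| := by
    intro y
    rw [← eq_rayMap_zero (scaling_onCircle (f := flatH1 χ M H 4 4) (flat_onCircle _)) p lam y]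
    rfl
  have h3 : ∀ y, |lam⁻¹ * (fun q => χ (radius q / q 0) * deriv χ (radius q)
      * (q 0 / hypTime q) ^ 2 * M) (ray (onCircle p y) lam)| = 0 := by
    intro y
    have := cutoff_mul_deriv_eq_zero hχ (h y)
    rw [rayMap] at this
    simp only [this, zero_mul, mul_zero, abs_zero]
  rw [A]
  simp only [h1, h2, h3, ciSup_const, add_zero]

/-- The energy inequality for `v = λ^{1/2} (3/2 φ + 𝒮φ)` and `z = λ^{3/2} ∂_y φ`. -/
lemma ray_energy {χ : ℝ → ℝ} (hχ : IsCutoff χ) {K M : ℝ} (hM : 0 < M) (hK : ∀ u, χ u ≤ K)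
    (N : SphereFrame) {H : TensorField} {φ F : Spacetime → ℝ} {p : Spacetime} {a : ℝ}
    (hφper : IsCirclePeriodic φ) (hp : p ∈ interiorRegion) (ha : 2 ≤ a) (hab : a ≤ hypTime p)
    (hint : ∀ l ∈ Icc a (hypTime p), ∀ y, rayMap p (l, y) ∈ interiorRegion)
    (hH : ∀ μ ν, ∀ l ∈ Icc a (hypTime p), ∀ y, ContDiffAt ℝ 1 (H μ ν) (rayMap p (l, y)))
    (hφ : ∀ l ∈ Icc a (hypTime p), ∀ y, ContDiffAt ℝ 2 φ (rayMap p (l, y)))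
    (htime : ∀ l ∈ Icc a (hypTime p), |timeCoef χ M N H (rayMap p (l, 0))| ≤ 1 / 4)
    (hcirc : ∀ l ∈ Icc a (hypTime p), |flatH1 χ M H 4 4 (rayMap p (l, 0))| ≤ 1 / 4)
    (heq : ∀ l ∈ Icc a (hypTime p), ∀ y, waveOp φ (rayMap p (l, y))
      + ∑ μ, ∑ ν, flat (H μ ν) (rayMap p (l, y)) * pd μ (pd ν φ) (rayMap p (l, y))
        = F (rayMap p (l, y))) :
    ContinuousOn (A χ M N H p) (Icc a (hypTime p)) ∧
    ContinuousOn (B χ M N H φ F p) (Icc a (hypTime p)) ∧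
    √(3 / 4) * Y φ p (hypTime p)
      ≤ (√(5 / 4 + 2 * M * K) * Y φ p a + 2 * ∫ l in a..(hypTime p), B χ M N H φ F p l)
        * Real.exp (∫ l in a..(hypTime p), A χ M N H p l) := by
  set b := hypTime p with hb
  have hs : 0 < hypTime p := hypTime_pos_of_mem hp
  have hpos : ∀ l ∈ Icc a b, 0 < l := fun l hl => by linarith [hl.1]
  have hpi : (0 : ℝ) ≤ 2 * Real.pi := by positivity
  have ht : ∀ l ∈ Icc a b, ∀ y, rayMap p (l, y) 0 ≠ 0 := fun l hl y => by
    linarith [two_le_of_mem (hint l hl y)]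
  have hlam : ∀ l ∈ Icc a b, ∀ y, hypTime (rayMap p (l, y)) = l := fun l hl y => by
    rw [rayMap_eq, hypTime_onCircle, hypTime_ray hs (hpos l hl).le]
  have hHc : ∀ μ ν, ∀ l ∈ Icc a b, ∀ y z,
      ContDiffAt ℝ 1 (H μ ν) (onCircle (rayMap p (l, y)) z) := fun μ ν l hl y z => by
    rw [rayMap_eq, onCircle_onCircle, ← rayMap_eq]; exact hH μ ν l hl z
  have hflat : ∀ μ ν, ∀ l ∈ Icc a b, ∀ y,
      ContDiffAt ℝ 1 (flatH1 χ M H μ ν) (rayMap p (l, y)) := fun μ ν l hl y =>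
    contDiffAt_flatH1 hχ M (ht l hl y) (hHc μ ν l hl y)
  have hcSum : ∀ μ ν, ∀ l ∈ Icc a b, ∀ y,
      ContDiffAt ℝ 1 (cSum N (flatH1 χ M H) μ ν) (rayMap p (l, y)) := fun μ ν l hl y =>
    contDiffAt_cSum N (ht l hl y) (fun μ ν => hflat μ ν l hl y) μ ν
  have htimeC : ∀ l ∈ Icc a b, ∀ y, ContDiffAt ℝ 1 (timeCoef χ M N H) (rayMap p (l, y)) := by
    intro l hl y
    have h1 := hypTime_pos_of_mem (hint l hl y)
    exact (((contDiffAt_coord 1 0 _).div (contDiffAt_hypTime h1) h1.ne').pow 2).mul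
      (hcSum 0 0 l hl y)
  -- continuity along the rays
  have hcomp : ∀ {f : Spacetime → ℝ}, (∀ l ∈ Icc a b, ∀ y, ContinuousAt f (rayMap p (l, y))) →
      ContinuousOn (fun q => f (rayMap p q)) (Icc a b ×ˢ univ) := fun hf q hq =>
    (ContinuousAt.comp (f := rayMap p) (hf q.1 hq.1 q.2)
      (continuous_rayMap p).continuousAt).continuousWithinAt
  have hcomp0 : ∀ {f : Spacetime → ℝ}, (∀ l ∈ Icc a b, ∀ y, ContinuousAt f (rayMap p (l, y))) →
      ContinuousOn (fun l => f (rayMap p (l, 0))) (Icc a b) := fun hf =>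
    (hcomp hf).comp (f := fun l : ℝ => (l, (0 : ℝ))) (by fun_prop) fun l hl => ⟨hl, mem_univ _⟩
  have hsc : ∀ {f : Spacetime → ℝ} {q : Spacetime}, ContDiffAt ℝ 1 f q →
      ContinuousAt (scaling f) q := by
    intro f q hf
    have hx : ∀ ν : Fin 5, ContinuousAt (fun q : Spacetime => q ν) q := fun ν =>
      (continuous_apply ν).continuousAt
    have h1 : ∀ μ, ContinuousAt (pd μ f) q := fun μ =>
      (hf.fderiv_right (m := 0) (by norm_num)).continuousAt.clm_apply continuousAt_const
    exact ((hx 0).mul (h1 0)).add (tendsto_finsetSum _ fun a _ => (hx (spat a)).mul (h1 (spat a)))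
  have hpd0 : ∀ {f : Spacetime → ℝ} {q : Spacetime} (μ : Fin 5), ContDiffAt ℝ 1 f q →
      ContinuousAt (pd μ f) q := fun μ hf =>
    (hf.fderiv_right (m := 0) (by norm_num)).continuousAt.clm_apply continuousAt_const
  have hinv : ContinuousOn (fun l : ℝ => l⁻¹) (Icc a b) :=
    continuousOn_id.inv₀ fun l hl => (hpos l hl).ne'
  have hAe : ∀ l ∈ Icc a b, A χ M N H p l
      = |l⁻¹ * scaling (timeCoef χ M N H) (rayMap p (l, 0))|
        + |l⁻¹ * scaling (flatH1 χ M H 4 4) (rayMap p (l, 0))| := fun l hl =>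
    A_eq hχ M N H (hint l hl)
  have hAc : ContinuousOn (A χ M N H p) (Icc a b) := by
    refine ContinuousOn.congr ?_ hAe
    exact (hinv.mul (hcomp0 fun l hl y => hsc (htimeC l hl y))).abs.add
      (hinv.mul (hcomp0 fun l hl y => hsc (hflat 4 4 l hl y))).abs
  -- the coefficients of the first order system
  set α : ℝ → ℝ := fun l => 1 + tailConst χ M p * l⁻¹ - timeCoef χ M N H (rayMap p (l, 0)) with hα
  set β : ℝ → ℝ := fun l => 1 + flatH1 χ M H 4 4 (rayMap p (l, 0)) with hβ
  set κ : ℝ → ℝ := fun l => l⁻¹ * (rayMap p (l, 0) 0 * (cSum N (flatH1 χ M H) 0 4 (rayMap p (l, 0))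
    + cSum N (flatH1 χ M H) 4 0 (rayMap p (l, 0)))) with hκ
  set v : ℝ × ℝ → ℝ := fun q => √q.1 * (3 / 2 * φ (rayMap p q) + scaling φ (rayMap p q)) with hv
  set vl : ℝ × ℝ → ℝ := fun q => (√q.1)⁻¹ * scalingOp φ (rayMap p q) with hvl
  set vy : ℝ × ℝ → ℝ := fun q =>
    √q.1 * (3 / 2 * pd 4 φ (rayMap p q) + pd 4 (scaling φ) (rayMap p q)) with hvy
  set z : ℝ × ℝ → ℝ := fun q => q.1 * √q.1 * pd 4 φ (rayMap p q) with hz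
  set zy : ℝ × ℝ → ℝ := fun q => q.1 * √q.1 * pd 4 (pd 4 φ) (rayMap p q) with hzy
  set ρ : ℝ × ℝ → ℝ := fun q => (√q.1)⁻¹ * remainder χ M N H φ F (rayMap p q) with hρ
  have hαd : ∀ l ∈ Icc a b, HasDerivAt α (tailConst χ M p * -(l ^ 2)⁻¹
      - l⁻¹ * scaling (timeCoef χ M N H) (rayMap p (l, 0))) l := fun l hl =>
    (((hasDerivAt_inv (hpos l hl).ne').const_mul _).const_add _).sub
      (hasDerivAt_ray (hpos l hl).ne' 0 ((htimeC l hl 0).differentiableAt (by simp)))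
  have hβd : ∀ l ∈ Icc a b, HasDerivAt β
      (l⁻¹ * scaling (flatH1 χ M H 4 4) (rayMap p (l, 0))) l := fun l hl =>
    (hasDerivAt_ray (hpos l hl).ne' 0 ((hflat 4 4 l hl 0).differentiableAt (by simp))).const_add _
  have hαc : ContinuousOn α (Icc a b) := fun l hl => (hαd l hl).continuousAt.continuousWithinAt
  have hβc : ContinuousOn β (Icc a b) := fun l hl => (hβd l hl).continuousAt.continuousWithinAt
  have hκc : ContinuousOn κ (Icc a b) :=
    hinv.mul ((hcomp0 (f := fun q => q 0) fun l hl y => (continuous_apply 0).continuousAt).mul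
      ((hcomp0 fun l hl y => (hcSum 0 4 l hl y).continuousAt).add
        (hcomp0 fun l hl y => (hcSum 4 0 l hl y).continuousAt)))
  have htailnn := tailConst_nonneg hχ hM.le p
  -- continuity of the unknowns
  have hsq : ContinuousOn (fun q : ℝ × ℝ => √q.1) (Icc a b ×ˢ univ) := by fun_prop
  have hsqi : ContinuousOn (fun q : ℝ × ℝ => (√q.1)⁻¹) (Icc a b ×ˢ univ) :=
    hsq.inv₀ fun q hq => (Real.sqrt_pos.mpr (hpos q.1 hq.1)).ne'
  have cφ : ContinuousOn (fun q => φ (rayMap p q)) (Icc a b ×ˢ univ) :=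
    hcomp fun l hl y => (hφ l hl y).continuousAt
  have cS : ContinuousOn (fun q => scaling φ (rayMap p q)) (Icc a b ×ˢ univ) :=
    hcomp fun l hl y => (contDiffAt_scaling (hφ l hl y)).continuousAt
  have cSS : ContinuousOn (fun q => scaling (scaling φ) (rayMap p q)) (Icc a b ×ˢ univ) :=
    hcomp fun l hl y => hsc (contDiffAt_scaling (hφ l hl y))
  have c4 : ContinuousOn (fun q => pd 4 φ (rayMap p q)) (Icc a b ×ˢ univ) :=
    hcomp fun l hl y => (contDiffAt_pd (hφ l hl y) 4).continuousAt
  have c44 : ContinuousOn (fun q => pd 4 (pd 4 φ) (rayMap p q)) (Icc a b ×ˢ univ) :=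
    hcomp fun l hl y => hpd0 4 (contDiffAt_pd (hφ l hl y) 4)
  have c4S : ContinuousOn (fun q => pd 4 (scaling φ) (rayMap p q)) (Icc a b ×ˢ univ) :=
    hcomp fun l hl y => hpd0 4 (contDiffAt_scaling (hφ l hl y))
  have cv : ContinuousOn v (Icc a b ×ˢ univ) := hsq.mul ((continuousOn_const.mul cφ).add cS)
  have cvl : ContinuousOn vl (Icc a b ×ˢ univ) :=
    hsqi.mul ((cSS.add (continuousOn_const.mul cS)).add (continuousOn_const.mul cφ))
  have cvy : ContinuousOn vy (Icc a b ×ˢ univ) := hsq.mul ((continuousOn_const.mul c4).add c4S)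
  have cz : ContinuousOn z (Icc a b ×ˢ univ) := (continuousOn_fst.mul hsq).mul c4
  have czy : ContinuousOn zy (Icc a b ×ˢ univ) := (continuousOn_fst.mul hsq).mul c44
  have hsys : ∀ l ∈ Icc a b, ∀ y,
      α l * vl (l, y) = β l * zy (l, y) + κ l * vy (l, y) + ρ (l, y) := by
    intro l hl y
    have hl0 := hpos l hl
    have h1 := remainder_eq (F := F) N (hφ l hl y) (ht l hl y)
      (hypTime_pos_of_mem (hint l hl y))
      (fun μ ν => flat_eq_add_flatH1 χ M (hHc μ ν l hl y)) (heq l hl y)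
    have h2 : flatH1 χ M H 4 4 (rayMap p (l, y)) = flatH1 χ M H 4 4 (rayMap p (l, 0)) :=
      eq_rayMap_zero (flat_onCircle _) p l y
    have h3 : timeCoef χ M N H (rayMap p (l, y)) = timeCoef χ M N H (rayMap p (l, 0)) :=
      eq_rayMap_zero (timeCoef_onCircle χ M N H) p l y
    have h4 : rayMap p (l, y) 0 = rayMap p (l, 0) 0 :=
      eq_rayMap_zero (f := fun q => q 0) onCircle_zero p l y
    have h5 : ∀ μ ν, cSum N (flatH1 χ M H) μ ν (rayMap p (l, y))
        = cSum N (flatH1 χ M H) μ ν (rayMap p (l, 0)) := fun μ ν =>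
      eq_rayMap_zero (cSum_onCircle N χ M H μ ν) p l y
    rw [timeCoef] at h3
    rw [tail_rayMap hχ M hs hl0 (hint l hl y), h3, hlam l hl y, h2, h4, h5, h5] at h1
    have hsl : √l ≠ 0 := (Real.sqrt_pos.mpr hl0).ne'
    have hsl2 : √l ^ 2 = l := Real.sq_sqrt hl0.le
    simp only [hα, hβ, hκ, hvl, hzy, hvy, hρ, h1]
    field_simp
    rw [hsl2]
    field_simp
    ring
  have cρ : ContinuousOn ρ (Icc a b ×ˢ univ) := by
    have hfst : MapsTo (Prod.fst : ℝ × ℝ → ℝ) (Icc a b ×ˢ univ) (Icc a b) := fun q hq => hq.1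
    refine ContinuousOn.congr (f := fun q => α q.1 * vl q - β q.1 * zy q - κ q.1 * vy q) ?_ ?_
    · exact (((hαc.comp continuousOn_fst hfst).mul cvl).sub
        ((hβc.comp continuousOn_fst hfst).mul czy)).sub ((hκc.comp continuousOn_fst hfst).mul cvy)
    · intro q hq
      have := hsys q.1 hq.1 q.2
      simp only [Prod.mk.eta] at this
      simp only
      linarith
  have hBe : ∀ l ∈ Icc a b, B χ M N H φ F p l = √(∫ y in (0 : ℝ)..(2 * Real.pi), ρ (l, y) ^ 2) := by
    intro l hl
    have h : ∀ y, l⁻¹ * remainder χ M N H φ F (ray (onCircle p y) l) ^ 2 = ρ (l, y) ^ 2 := by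
      intro y
      simp only [hρ, mul_pow, inv_pow, Real.sq_sqrt (hpos l hl).le]
      rfl
    simp only [B, h]
  have hYe : ∀ l ∈ Icc a b, Y φ p l = √((∫ y in (0 : ℝ)..(2 * Real.pi), v (l, y) ^ 2)
      + ∫ y in (0 : ℝ)..(2 * Real.pi), z (l, y) ^ 2) := by
    intro l hl
    have i1 : Continuous fun y => v (l, y) ^ 2 := (continuous_slice cv hl).pow 2
    have i2 : Continuous fun y => z (l, y) ^ 2 := (continuous_slice cz hl).pow 2
    rw [← intervalIntegral.integral_add (i1.intervalIntegrable _ _) (i2.intervalIntegrable _ _)]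
    have h : ∀ y, l * (3 / 2 * φ (ray (onCircle p y) l) + scaling φ (ray (onCircle p y) l)) ^ 2
        + l ^ 3 * pd 4 φ (ray (onCircle p y) l) ^ 2 = v (l, y) ^ 2 + z (l, y) ^ 2 := by
      intro y
      simp only [hv, hz, mul_pow, Real.sq_sqrt (hpos l hl).le, rayMap]
      ring
    simp only [Y, h]
  have hBc : ContinuousOn (B χ M N H φ F p) (Icc a b) :=
    (continuousOn_circleIntegral (cρ.pow 2) 0 (2 * Real.pi)).sqrt.congr hBe
  refine ⟨hAc, hBc, ?_⟩
  have hα1 : ∀ l ∈ Icc a b, 3 / 4 ≤ α l := by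
    intro l hl
    have h1 : 0 ≤ tailConst χ M p * l⁻¹ := mul_nonneg htailnn (inv_nonneg.mpr (hpos l hl).le)
    have := (abs_le.mp (htime l hl)).2
    simp only [hα]; linarith
  have hβ1 : ∀ l ∈ Icc a b, 3 / 4 ≤ β l := by
    intro l hl
    have := (abs_le.mp (hcirc l hl)).1
    simp only [hβ]; linarith
  have henergy := energy_inequality (d := 2 * Real.pi) hab hpi cv cvl cvy cz czy cρ hAc
    (fun l hl => by rw [hAe l hl]; positivity) hαd hβd hα1 hβ1 ?_ ?_ ?_ ?_ ?_ ?_ ?_ ?_ hsys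
  · have hbm : b ∈ Icc a b := right_mem_Icc.mpr hab
    have ham : a ∈ Icc a b := left_mem_Icc.mpr hab
    have hV0 : ∀ l, 0 ≤ ∫ y in (0 : ℝ)..(2 * Real.pi), v (l, y) ^ 2 := fun l =>
      intervalIntegral.integral_nonneg hpi fun _ _ => sq_nonneg _
    have hZ0 : ∀ l, 0 ≤ ∫ y in (0 : ℝ)..(2 * Real.pi), z (l, y) ^ 2 := fun l =>
      intervalIntegral.integral_nonneg hpi fun _ _ => sq_nonneg _
    have hlow : √(3 / 4) * Y φ p b ≤ √(α b * (∫ y in (0 : ℝ)..(2 * Real.pi), v (b, y) ^ 2)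
        + β b * ∫ y in (0 : ℝ)..(2 * Real.pi), z (b, y) ^ 2) := by
      rw [hYe b hbm, ← Real.sqrt_mul (by norm_num)]
      refine Real.sqrt_le_sqrt ?_
      rw [mul_add]
      exact add_le_add (mul_le_mul_of_nonneg_right (hα1 b hbm) (hV0 b))
        (mul_le_mul_of_nonneg_right (hβ1 b hbm) (hZ0 b))
    have hK0 : 0 ≤ K := (hχ.nonneg 0).trans (hK 0)
    have hMK : 0 ≤ 2 * M * K := by positivity
    have hαu : α a ≤ 5 / 4 + 2 * M * K := by
      have h1 := tail_mul_le hχ hM.le hK (hint a ham 0)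
      rw [tail_rayMap hχ M hs (hpos a ham) (hint a ham 0), div_eq_mul_inv] at h1
      have := (abs_le.mp (htime a ham)).1
      simp only [hα]; linarith
    have hβu : β a ≤ 5 / 4 + 2 * M * K := by
      have := (abs_le.mp (hcirc a ham)).2
      simp only [hβ]; linarith
    have hup : √(α a * (∫ y in (0 : ℝ)..(2 * Real.pi), v (a, y) ^ 2)
        + β a * ∫ y in (0 : ℝ)..(2 * Real.pi), z (a, y) ^ 2)
        ≤ √(5 / 4 + 2 * M * K) * Y φ p a := by
      rw [hYe a ham, ← Real.sqrt_mul (by positivity)]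
      refine Real.sqrt_le_sqrt ?_
      rw [mul_add]
      exact add_le_add (mul_le_mul_of_nonneg_right hαu (hV0 a))
        (mul_le_mul_of_nonneg_right hβu (hZ0 a))
    have hBint : ∫ l in a..b, √(∫ y in (0 : ℝ)..(2 * Real.pi), ρ (l, y) ^ 2)
        = ∫ l in a..b, B χ M N H φ F p l :=
      intervalIntegral.integral_congr fun l hl => by
        rw [uIcc_of_le hab] at hl; exact (hBe l hl).symm
    rw [hBint] at henergy
    refine hlow.trans (henergy.trans ?_)
    exact mul_le_mul_of_nonneg_right (by linarith) (Real.exp_pos _).le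
  · intro l hl
    rw [hAe l hl]
    have h1 := neg_abs_le (l⁻¹ * scaling (timeCoef χ M N H) (rayMap p (l, 0)))
    have h2 := abs_nonneg (l⁻¹ * scaling (flatH1 χ M H 4 4) (rayMap p (l, 0)))
    have h3 : 0 ≤ tailConst χ M p * (l ^ 2)⁻¹ := mul_nonneg htailnn (by positivity)
    linarith
  · intro l hl
    rw [hAe l hl]
    have h1 := abs_nonneg (l⁻¹ * scaling (timeCoef χ M N H) (rayMap p (l, 0)))
    have h2 := le_abs_self (l⁻¹ * scaling (flatH1 χ M H 4 4) (rayMap p (l, 0)))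
    linarith
  · intro l hl y
    have hl0 := hpos l hl
    have h1 := hasDerivAt_ray hl0.ne' y ((hφ l hl y).differentiableAt (by simp))
    have h2 := hasDerivAt_ray hl0.ne' y ((contDiffAt_scaling (hφ l hl y)).differentiableAt (by simp))
    refine ((Real.hasDerivAt_sqrt hl0.ne').mul ((h1.const_mul (3 / 2)).add h2)).congr_deriv ?_
    have hsl : √l ≠ 0 := (Real.sqrt_pos.mpr hl0).ne'
    have hsl2 : √l ^ 2 = l := Real.sq_sqrt hl0.le
    simp only [hvl, scalingOp, Pi.add_apply]
    field_simp
    rw [hsl2]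
    field_simp
    ring
  · intro l hl y
    have hl0 := hpos l hl
    have h1 := hasDerivAt_ray hl0.ne' y ((contDiffAt_pd (hφ l hl y) 4).differentiableAt (by simp))
    refine (((hasDerivAt_id l).mul (Real.hasDerivAt_sqrt hl0.ne')).mul h1).congr_deriv ?_
    have hsl : √l ≠ 0 := (Real.sqrt_pos.mpr hl0).ne'
    have hsl2 : √l ^ 2 = l := Real.sq_sqrt hl0.le
    simp only [hvy, pd_four_scaling (hφ l hl y), id, Pi.mul_apply]
    field_simp
    rw [hsl2]
    ring
  · intro l hl y
    exact (((hasDerivAt_circle ((hφ l hl y).differentiableAt (by simp))).const_mul (3 / 2)).add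
      (hasDerivAt_circle ((contDiffAt_scaling (hφ l hl y)).differentiableAt (by simp)))).const_mul √l
  · intro l hl y
    exact (hasDerivAt_circle
      ((contDiffAt_pd (hφ l hl y) 4).differentiableAt (by simp))).const_mul (l * √l)
  · intro l _
    have h : ∀ {f : Spacetime → ℝ}, IsCirclePeriodic f →
        f (rayMap p (l, 2 * Real.pi)) = f (rayMap p (l, 0)) := fun hf => by
      simpa [rayMap_eq] using hf (ray p l) 0
    simp only [hv, h hφper, h hφper.scaling]
  · intro l _
    have h : ∀ {f : Spacetime → ℝ}, IsCirclePeriodic f →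
        f (rayMap p (l, 2 * Real.pi)) = f (rayMap p (l, 0)) := fun hf => by
      simpa [rayMap_eq] using hf (ray p l) 0
    simp only [hz, h (hφper.pd 4)]

/-- The energy at `(t, x)` controls the left-hand side of the estimate, as `φ` is mean-free. -/
lemma norms_le_Y {φ : Spacetime → ℝ} {p : Spacetime} (hs : 1 ≤ hypTime p)
    (hφ : ∀ y, ContDiffAt ℝ 2 φ (onCircle p y))
    (h0 : ∫ y in (0 : ℝ)..(2 * Real.pi), φ (onCircle p y) = 0) :
    hypTime p ^ (3 / 2 : ℝ) * (circleNorm φ p + circleNorm (pd 4 φ) p)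
      + hypTime p ^ (1 / 2 : ℝ) * circleNorm (scaling φ) p
      ≤ (3 + 8 * Real.pi) * Y φ p (hypTime p) := by
  have hs0 : 0 < hypTime p := by linarith
  have hpi : (0 : ℝ) < 2 * Real.pi := by positivity
  set s := hypTime p with hsdef
  have hray : ∀ y, ray (onCircle p y) s = onCircle p y := by
    intro y
    rw [ray_onCircle, ray_hypTime hs0]
  have hcirc : Continuous fun y : ℝ => onCircle p y := by simp only [onCircle_eq]; fun_prop
  have hc : ∀ {f : Spacetime → ℝ}, (∀ y, ContinuousAt f (onCircle p y)) →
      Continuous fun y => f (onCircle p y) := fun hf =>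
    continuous_iff_continuousAt.mpr fun y =>
      ContinuousAt.comp (f := fun z : ℝ => onCircle p z) (hf y) hcirc.continuousAt
  have cφ := hc fun y => (hφ y).continuousAt
  have cS := hc fun y => (contDiffAt_scaling (hφ y)).continuousAt
  have c4 := hc fun y => (contDiffAt_pd (hφ y) 4).continuousAt
  have hpoinc : circleNorm φ p ≤ 2 * Real.pi * circleNorm (pd 4 φ) p := by
    refine sqrt_integral_sq_le_deriv (fun y => ?_) c4 hpi h0
    have h1 : ∀ y, rayMap p (s, y) = onCircle p y := hray
    have h2 := hasDerivAt_circle (f := φ) (p := p) (lam := s) (y := y)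
      (by rw [h1]; exact (hφ y).differentiableAt (by simp))
    simpa only [h1] using h2
  have cW : Continuous fun y => (3 / 2 * φ (onCircle p y) + scaling φ (onCircle p y)) ^ 2 :=
    ((continuous_const.mul cφ).add cS).pow 2
  set W := ∫ y in (0 : ℝ)..(2 * Real.pi),
    (3 / 2 * φ (onCircle p y) + scaling φ (onCircle p y)) ^ 2 with hW
  set Z := ∫ y in (0 : ℝ)..(2 * Real.pi), pd 4 φ (onCircle p y) ^ 2 with hZ
  have hW0 : 0 ≤ W := intervalIntegral.integral_nonneg hpi.le fun _ _ => sq_nonneg _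
  have hZ0 : 0 ≤ Z := intervalIntegral.integral_nonneg hpi.le fun _ _ => sq_nonneg _
  have hY : Y φ p s = √(s * W + s ^ 3 * Z) := by
    simp only [Y, hray]
    rw [hW, hZ, ← intervalIntegral.integral_const_mul, ← intervalIntegral.integral_const_mul,
      ← intervalIntegral.integral_add]
    · exact (continuous_const.mul cW).intervalIntegrable _ _
    · exact (continuous_const.mul (c4.pow 2)).intervalIntegrable _ _
  have e1 : s ^ (1 / 2 : ℝ) = √s := (Real.sqrt_eq_rpow s).symm
  have e2 : s ^ (3 / 2 : ℝ) = s * √s := by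
    rw [show (3 / 2 : ℝ) = 1 + 1 / 2 by norm_num, Real.rpow_add hs0, Real.rpow_one, e1]
  have h1 : s * √s * circleNorm (pd 4 φ) p ≤ Y φ p s := by
    rw [hY, circleNorm, ← hZ]
    refine Real.le_sqrt_of_sq_le ?_
    rw [mul_pow, mul_pow, Real.sq_sqrt hs0.le, Real.sq_sqrt hZ0]
    have : 0 ≤ s * W := by positivity
    nlinarith
  have h2 : √s * √W ≤ Y φ p s := by
    rw [hY]
    refine Real.le_sqrt_of_sq_le ?_
    rw [mul_pow, Real.sq_sqrt hs0.le, Real.sq_sqrt hW0]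
    have : 0 ≤ s ^ 3 * Z := by positivity
    linarith
  set P := circleNorm φ p with hP
  have hP0 : 0 ≤ P := Real.sqrt_nonneg _
  have h3 : circleNorm (scaling φ) p ≤ 2 * √W + 3 * P := by
    have hP2 : P ^ 2 = ∫ y in (0 : ℝ)..(2 * Real.pi), φ (onCircle p y) ^ 2 :=
      Real.sq_sqrt (intervalIntegral.integral_nonneg hpi.le fun _ _ => sq_nonneg _)
    refine Real.sqrt_le_iff.mpr ⟨by positivity, ?_⟩
    have h4 : ∫ y in (0 : ℝ)..(2 * Real.pi), scaling φ (onCircle p y) ^ 2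
        ≤ 2 * W + 9 / 2 * P ^ 2 := by
      rw [hP2, hW, ← intervalIntegral.integral_const_mul, ← intervalIntegral.integral_const_mul,
        ← intervalIntegral.integral_add]
      · refine intervalIntegral.integral_mono_on hpi.le ?_ ?_ fun y _ => ?_
        · exact (cS.pow 2).intervalIntegrable _ _
        · exact ((continuous_const.mul cW).add
            (continuous_const.mul (cφ.pow 2))).intervalIntegrable _ _
        · nlinarith [sq_nonneg (3 * φ (onCircle p y) + scaling φ (onCircle p y))]
      · exact (continuous_const.mul cW).intervalIntegrable _ _
      · exact (continuous_const.mul (cφ.pow 2)).intervalIntegrable _ _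
    have h5 := Real.sq_sqrt hW0
    nlinarith [mul_nonneg (Real.sqrt_nonneg W) hP0, sq_nonneg P]
  rw [e1, e2]
  have hsq := Real.sqrt_nonneg s
  have h6 : s * √s * P ≤ 2 * Real.pi * Y φ p s := by
    calc s * √s * P ≤ s * √s * (2 * Real.pi * circleNorm (pd 4 φ) p) :=
          mul_le_mul_of_nonneg_left hpoinc (by positivity)
      _ = 2 * Real.pi * (s * √s * circleNorm (pd 4 φ) p) := by ring
      _ ≤ _ := mul_le_mul_of_nonneg_left h1 hpi.le
  have h7 : √s * P ≤ s * √s * P := by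
    have : 0 ≤ √s * P := by positivity
    nlinarith
  have h8 := mul_le_mul_of_nonneg_left h3 hsq
  linarith

end KaluzaKlein

end

theorem proposition4p20 :
    ∃ ε₀ : ℝ, 0 < ε₀ ∧
    ∀ χ : ℝ → ℝ, KaluzaKlein.IsCutoff χ →
    ∀ M₀ : ℝ, ∃ C : ℝ, 0 < C ∧
    ∀ M : ℝ, 0 < M → M ≤ M₀ →
    ∀ (N : KaluzaKlein.SphereFrame) (s₀ S₀ : ℝ), 2 ≤ s₀ →
    ∀ (H : KaluzaKlein.TensorField) (φ F : KaluzaKlein.Spacetime → ℝ),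
      -- `H` is a symmetric tensor field on `ℝ^{1+3} × S¹`, of class `C¹` near the slab
      (∀ μ ν, H μ ν = H ν μ) →
      (∀ μ ν, KaluzaKlein.IsCirclePeriodic (H μ ν)) →
      (∀ μ ν, ∀ p ∈ KaluzaKlein.hypSlab s₀ S₀, ContDiffAt ℝ 1 (H μ ν) p) →
      -- smallness of `(H¹)^♭` and of its `LL` component
      (∀ μ ν, ∀ p ∈ KaluzaKlein.hypSlab s₀ S₀, |KaluzaKlein.flatH1 χ M H μ ν p| ≤ ε₀) →
      (∀ p ∈ KaluzaKlein.hypSlab s₀ S₀,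
        |KaluzaKlein.lowerComp (KaluzaKlein.flatH1 χ M H)
          (KaluzaKlein.nullVec N 0 p) (KaluzaKlein.nullVec N 0 p) p|
          ≤ ε₀ * (KaluzaKlein.hypTime p / p 0) ^ 2) →
      -- `φ` is a function on `ℝ^{1+3} × S¹` of class `C²` near the slab, of zero average
      KaluzaKlein.IsCirclePeriodic φ →
      (∀ p ∈ KaluzaKlein.hypSlab s₀ S₀, ContDiffAt ℝ 2 φ p) →
      (∀ p ∈ KaluzaKlein.hypSlab s₀ S₀,
        ∫ y in (0 : ℝ)..(2 * Real.pi), φ (KaluzaKlein.onCircle p y) = 0) →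
      -- the equation
      (∀ p ∈ KaluzaKlein.hypSlab s₀ S₀,
        KaluzaKlein.waveOp φ p
          + ∑ μ, ∑ ν, KaluzaKlein.flat (H μ ν) p * KaluzaKlein.pd μ (KaluzaKlein.pd ν φ) p
          = F p) →
      -- the estimate, on the part of the ray from the parameter `lam₀` to `(t, x)`
      ∀ p ∈ KaluzaKlein.hypSlab s₀ S₀,
      ∀ lam₀ : ℝ, s₀ ≤ lam₀ → lam₀ ≤ KaluzaKlein.hypTime p →
        KaluzaKlein.ray p lam₀ ∈ KaluzaKlein.interiorRegion →
        IntervalIntegrable (KaluzaKlein.A χ M N H p) MeasureTheory.volume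
            lam₀ (KaluzaKlein.hypTime p) ∧
        IntervalIntegrable (KaluzaKlein.B χ M N H φ F p) MeasureTheory.volume
            lam₀ (KaluzaKlein.hypTime p) ∧
        KaluzaKlein.hypTime p ^ (3 / 2 : ℝ)
              * (KaluzaKlein.circleNorm φ p + KaluzaKlein.circleNorm (KaluzaKlein.pd 4 φ) p)
            + KaluzaKlein.hypTime p ^ (1 / 2 : ℝ)
              * KaluzaKlein.circleNorm (KaluzaKlein.scaling φ) p
          ≤ C * (KaluzaKlein.Y φ p lam₀
                + ∫ lam in lam₀..(KaluzaKlein.hypTime p), KaluzaKlein.B χ M N H φ F p lam)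
              * Real.exp (∫ lam in lam₀..(KaluzaKlein.hypTime p),
                  KaluzaKlein.A χ M N H p lam) := by
  -- `1/304 = (1/4) / 76`, with the constant of `abs_cSum_zero_zero_le`
  refine ⟨1 / 304, by norm_num, fun χ hχ M₀ => ?_⟩
  obtain ⟨K, hK⟩ := KaluzaKlein.exists_cutoff_le hχ
  have hK0 : 0 ≤ K := (hχ.nonneg 0).trans (hK 0)
  have hpi := Real.pi_pos
  refine ⟨2 * (3 + 8 * Real.pi) * (√(5 / 4 + 2 * M₀ * K) + 2), by positivity, ?_⟩
  intro M hM hMM N s₀ S₀ hs₀ H φ F _ _ hH hsmall hLL hφper hφ hφ0 heq p hp lam₀ hl₀ hl₁ hl₂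
  have hmem : ∀ l ∈ Set.Icc lam₀ (KaluzaKlein.hypTime p), ∀ y,
      KaluzaKlein.rayMap p (l, y) ∈ KaluzaKlein.hypSlab s₀ S₀ := fun l hl y =>
    KaluzaKlein.rayMap_mem_hypSlab hs₀ hp hl₀ hl₂ hl.1 hl.2 y
  obtain ⟨hAc, hBc, hE⟩ := KaluzaKlein.ray_energy hχ hM hK N (F := F) hφper hp.1
    (hs₀.trans hl₀) hl₁ (fun l hl y => (hmem l hl y).1) (fun μ ν l hl y => hH μ ν _ (hmem l hl y))
    (fun l hl y => hφ _ (hmem l hl y))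
    (fun l hl => (KaluzaKlein.abs_cSum_zero_zero_le N _ (hmem l hl 0).1
      (fun μ ν => hsmall μ ν _ (hmem l hl 0)) (hLL _ (hmem l hl 0))).trans (by norm_num))
    (fun l hl => (hsmall 4 4 _ (hmem l hl 0)).trans (by norm_num))
    (fun l hl y => heq _ (hmem l hl y))
  refine ⟨hAc.intervalIntegrable_of_Icc hl₁, hBc.intervalIntegrable_of_Icc hl₁, ?_⟩
  have hs2 : 1 ≤ KaluzaKlein.hypTime p := by linarith
  refine (KaluzaKlein.norms_le_Y hs2
    (fun y => hφ _ (KaluzaKlein.onCircle_mem_hypSlab hp y)) (hφ0 p hp)).trans ?_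
  have hB0 : 0 ≤ ∫ l in lam₀..(KaluzaKlein.hypTime p), KaluzaKlein.B χ M N H φ F p l :=
    intervalIntegral.integral_nonneg hl₁ fun _ _ => Real.sqrt_nonneg _
  have hYa : 0 ≤ KaluzaKlein.Y φ p lam₀ := Real.sqrt_nonneg _
  have hYb : 0 ≤ KaluzaKlein.Y φ p (KaluzaKlein.hypTime p) := Real.sqrt_nonneg _
  have hexp := Real.exp_pos (∫ l in lam₀..(KaluzaKlein.hypTime p), KaluzaKlein.A χ M N H p l)
  have hhalf : (1 / 2 : ℝ) ≤ √(3 / 4) := Real.le_sqrt_of_sq_le (by norm_num)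
  have hC : √(5 / 4 + 2 * M * K) ≤ √(5 / 4 + 2 * M₀ * K) := by gcongr
  have hC0 := Real.sqrt_nonneg (5 / 4 + 2 * M₀ * K)
  have h1 : √(5 / 4 + 2 * M * K) * KaluzaKlein.Y φ p lam₀
      + 2 * ∫ l in lam₀..(KaluzaKlein.hypTime p), KaluzaKlein.B χ M N H φ F p l
      ≤ (√(5 / 4 + 2 * M₀ * K) + 2) * (KaluzaKlein.Y φ p lam₀
        + ∫ l in lam₀..(KaluzaKlein.hypTime p), KaluzaKlein.B χ M N H φ F p l) := by
    nlinarith [mul_le_mul_of_nonneg_right hC hYa, mul_nonneg hC0 hB0]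
  have h2 := hE.trans (mul_le_mul_of_nonneg_right h1 hexp.le)
  have h3 := mul_le_mul_of_nonneg_right hhalf hYb
  have h4 := mul_le_mul_of_nonneg_left (h3.trans h2) (show 0 ≤ 2 * (3 + 8 * Real.pi) by positivity)
  linarith
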